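/- **Setting.** Let $\bar{\mathcal M}$ be a compact Hausdorff smooth manifold with boundary (corners allowed), of dimension $D$, with interior $\mathcal M$. Let $g$ be a continuous Lorentzian metric of signature $(-,+,\dots,+)$ on $\mathcal M$, with a time orientation given by a continuous timelike vector field on $\mathcal M$. Assume that the causal structure extends to $\bar{\mathcal M}$: on $\mathcal M$, $g$ is a positive function times (the restriction of) a continuous Lorentzian metric on $\bar{\mathcal M}$. Let $D(A),D(B)\subseteq\partial\bar{\mathcal M}$ be arbitrary subsets (for instance the causal domains of boundary regions $A$, $B$), and let $U$ be a continuous 1-form on $\bar{\mathcal M}$. A covector $W$ at $x\in\mathcal M$ is *future-directed causal*, $W\in\mathfrak j^+$, if $W(v)\ge 0$ for every future-directed causal vector $v$ (so $0\in\mathfrak j^+$). For covectors $W,X$ at $x$ put $W\cdot X=g^{\mu\nu}W_\mu X_\nu$, $W^2=W\cdot W$, $|W\wedge X|=\sqrt{|W^2X^2-(W\cdot X)^2|}$, and $$\langle W,X\rangle:=\max\{|W\cdot X|,\,|W\wedge X|\}.$$ A *curve in $\mathcal M$* from $p\in\bar{\mathcal M}$ to $q\in\bar{\mathcal M}$ is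 a continuous map $x:[a,b]\to\bar{\mathcal M}$, $a<b$, with $x(a)=p$, $x(b)=q$, $x(s)\in\mathcal M$ for $a<s<b$, that is $C^1$ on $(a,b)$ except at finitely many parameters. Its path integral is $\int_a^b ds\,\langle U,\dot x\rangle\in[0,\infty]$, where $\dot x$ is the covector dual to the tangent vector $dx^\mu/ds$. **Theorem.** The following two conditions are equivalent. 1. There is a function $\psi:\bar{\mathcal M}\to[-\tfrac12,\tfrac12]$, locally Lipschitz in coordinates (up to and including the boundary), with $\psi|_{D(A)}=-\tfrac12$ and $\psi|_{D(B)}=+\tfrac12$, such that at almost every point of $\mathcal M$, $\psi$ is differentiable and $U+d\psi\in\mathfrak j^+$ and $U-d\psi\in\mathfrak j^+$. 2. $U\in\mathfrak j^+$ at every point of $\mathcal M$, and $\int_p ds\,\langle U,\dot x\rangle\ge 1$ for every curve $p$ in $\mathcal M$ starting in $D(A)$ and ending in $D(B)$. Moreover, let $\psi_-(y)$ and $\psi_+(y)$ be the infima in $[0,\infty]$ of $\int_p ds\,\langle U,\dot x\rangle$ over all curves $p$ in $\mathcal M$ from $D(A)$ to $y$, respectively from $D(B)$ to $y$ (with value $\infty$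 if there is none). If condition 2 holds, then condition 1 is satisfied by $$\psi(y)=\begin{cases}\psi_-(y)-\tfrac12,&\psi_-(y)<\tfrac12,\\ \tfrac12-\psi_+(y),&\psi_-(y)\ge\tfrac12\text{ and }\psi_+(y)<\tfrac12,\\ 0,&\text{otherwise.}\end{cases}$$ -/

import Mathlib

open Set MeasureTheory Manifold
open scoped ENNReal ContDiff Topology

noncomputable section

namespace UFlow

section

variable {D : ℕ} {H : Type*} [TopologicalSpace H]
  (I : ModelWithCorners ℝ (EuclideanSpace ℝ (Fin D)) H)
  (M : Type*) [TopologicalSpace M] [ChartedSpace H M]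

/-- A field of covectors (a 1-form, with no regularity imposed). -/
abbrev OneForm : Type _ := ∀ x : M, TangentSpace I x →L[ℝ] ℝ

/-- A field of bilinear forms on the tangent spaces. -/
abbrev BilinField : Type _ := ∀ x : M, TangentSpace I x →L[ℝ] TangentSpace I x →L[ℝ] ℝ

variable {M}

/-- `g` is a (continuous) Lorentzian metric on the set `s`, of signature `(-,+,…,+)`. -/
structure IsLorentzianOn [IsManifold I ∞ M] (g : BilinField I M) (s : Set M) : Prop where
  symm : ∀ x ∈ s, ∀ v w : TangentSpace I x, g x v w = g x w v
  signature : ∀ x ∈ s, ∃ t : TangentSpace I x, g x t t < 0 ∧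
    ∀ v : TangentSpace I x, g x t v = 0 → v ≠ 0 → 0 < g x v v
  continuousOn : ContinuousOn (fun x : M ↦ Bundle.TotalSpace.mk'
    (EuclideanSpace ℝ (Fin D) →L[ℝ] EuclideanSpace ℝ (Fin D) →L[ℝ] ℝ)
    (E := fun x : M ↦ TangentSpace I x →L[ℝ] TangentSpace I x →L[ℝ] ℝ) x (g x)) s

variable (M)

/-- The data of a spacetime: `M` plays the role of the manifold with boundary, and the metric `g`
and the time orientation live on its interior (values at boundary points are irrelevant).
The time orientation is given by a continuous timelike vector field `T`, declared to be
future-directed. The causal structure extends to the boundary: on the interior, `g` is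
(pointwise) conformal to a Lorentzian metric `ĝ` defined on all of `M`. -/
structure Spacetime [IsManifold I ∞ M] where
  g : BilinField I M
  lorentzian : IsLorentzianOn I g (I.interior M)
  T : ∀ x : M, TangentSpace I x
  T_continuousOn : ContinuousOn (fun x : M ↦ Bundle.TotalSpace.mk'
    (EuclideanSpace ℝ (Fin D)) (E := fun x : M ↦ TangentSpace I x) x (T x)) (I.interior M)
  T_timelike : ∀ x ∈ I.interior M, g x (T x) (T x) < 0
  causal_extends : ∃ ĝ : BilinField I M, IsLorentzianOn I ĝ univ ∧
    ∀ x ∈ I.interior M, ∃ c : ℝ, 0 < c ∧ ∀ v w : TangentSpace I x, g x v w = c * ĝ x v w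

variable {M}

/-- The 1-form `U` is continuous on the whole of `M`, boundary included. -/
def IsContinuousOneForm [IsManifold I ∞ M] (U : OneForm I M) : Prop :=
  Continuous (fun x : M ↦ Bundle.TotalSpace.mk' (EuclideanSpace ℝ (Fin D) →L[ℝ] ℝ)
    (E := fun x : M ↦ TangentSpace I x →L[ℝ] ℝ) x (U x))

/-- `ψ` is Lipschitz, in local coordinates, near each point (boundary points included). -/
def IsLocallyLipschitz (ψ : M → ℝ) : Prop :=
  ∀ x : M, ∃ K, ∃ s ∈ 𝓝[range I] (extChartAt I x x),
    LipschitzOnWith K (ψ ∘ (extChartAt I x).symm) s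

/-- `P` holds at almost every point: its failure set is Lebesgue-null in every preferred chart. -/
def AlmostEverywhere (P : M → Prop) : Prop :=
  ∀ x₀ : M, ∀ᵐ y : EuclideanSpace ℝ (Fin D),
    y ∈ (extChartAt I x₀).target → P ((extChartAt I x₀).symm y)

/-- The differential of a real function, as a covector at `x`. -/
def diff (ψ : M → ℝ) (x : M) : TangentSpace I x →L[ℝ] ℝ := mfderiv I 𝓘(ℝ, ℝ) ψ x

/-- The velocity of a parametrized curve. -/
def velocity (γ : ℝ → M) (t : ℝ) : TangentSpace I (γ t) := mfderiv 𝓘(ℝ, ℝ) I γ t (1 : ℝ)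

/-- `γ`, restricted to `[a, b]`, is a parametrized curve in the interior of `M`, whose two ends are
allowed to lie on the boundary: it is continuous on `[a, b]`, runs in the interior for parameters
in `(a, b)`, and is `C¹` on `(a, b)` except at finitely many parameters. -/
structure IsCurve (γ : ℝ → M) (a b : ℝ) : Prop where
  lt : a < b
  continuousOn : ContinuousOn γ (Icc a b)
  mapsTo : MapsTo γ (Ioo a b) (I.interior M)
  piecewise : ∃ s : Finset ℝ, ∀ t ∈ Ioo a b, t ∉ s → ContMDiffAt 𝓘(ℝ, ℝ) I 1 γ t

namespace Spacetime

variable {I} [IsManifold I ∞ M] (S : Spacetime I M)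

/-- Nonzero causal vectors lying in the future half of the light cone. -/
def FutureCausalVec (x : M) (v : TangentSpace I x) : Prop :=
  v ≠ 0 ∧ S.g x v v ≤ 0 ∧ S.g x (S.T x) v < 0

/-- The cone of future-directed causal covectors at `x`: those that evaluate non-negatively on
every future-directed causal vector. -/
def fdc (x : M) : Set (TangentSpace I x →L[ℝ] ℝ) :=
  {W | ∀ v : TangentSpace I x, S.FutureCausalVec x v → 0 ≤ W v}

/-- The vector dual to a covector: the inverse of `v ↦ g x v`. -/
def sharp (x : M) (W : TangentSpace I x →L[ℝ] ℝ) : TangentSpace I x :=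
  ContinuousLinearMap.inverse (S.g x) W

/-- The inner product `W · X` of covectors defined by the inverse metric. -/
def dot (x : M) (W X : TangentSpace I x →L[ℝ] ℝ) : ℝ := W (S.sharp x X)

/-- The norm `|W ∧ X|`, the square root of `|(W ∧ X)_{μν} (W ∧ X)^{μν}| / 2`, where
`(W ∧ X)_{μν} = W_μ X_ν - X_μ W_ν`. -/
def wedgeNorm (x : M) (W X : TangentSpace I x →L[ℝ] ℝ) : ℝ :=
  Real.sqrt |S.dot x W W * S.dot x X X - S.dot x W X ^ 2|

/-- The wedgedot pairing of covectors. -/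
def wedgedot (x : M) (W X : TangentSpace I x →L[ℝ] ℝ) : ℝ :=
  max |S.dot x W X| (S.wedgeNorm x W X)

/-- The integral over the curve `γ` on `[a, b]` of the wedgedot of `U` with the covector dual to
the velocity; the integrand is non-negative and the integral takes values in `[0, ∞]`. -/
def pathIntegral (U : OneForm I M) (γ : ℝ → M) (a b : ℝ) : ℝ≥0∞ :=
  ∫⁻ t in Ioo a b, ENNReal.ofReal (S.wedgedot (γ t) (U (γ t)) (S.g (γ t) (velocity I γ t)))

/-- `ψ` is a relaxed time-sheet function: it takes values in `[-1/2, 1/2]`, is `-1/2` on `DA` and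
`1/2` on `DB`; and it witnesses the norm bound for `U`: `U ± dψ` is future-directed causal
(almost everywhere in the interior). -/
structure IsWitness (U : OneForm I M) (DA DB : Set M) (ψ : M → ℝ) : Prop where
  mem_Icc : ∀ x, ψ x ∈ Icc (-1 / 2 : ℝ) (1 / 2)
  eq_on_A : ∀ x ∈ DA, ψ x = -1 / 2
  eq_on_B : ∀ x ∈ DB, ψ x = 1 / 2
  lipschitz : IsLocallyLipschitz I ψ
  bound : AlmostEverywhere I fun x : M ↦ x ∈ I.interior M →
    MDifferentiableAt I 𝓘(ℝ, ℝ) ψ x ∧ U x + diff I ψ x ∈ S.fdc x ∧ U x - diff I ψ x ∈ S.fdc x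

/-- `U` is future-directed causal, and its integral over every curve from `DA` to `DB` is at least
one. -/
def NormBound (U : OneForm I M) (DA DB : Set M) : Prop :=
  (∀ x ∈ I.interior M, U x ∈ S.fdc x) ∧
    ∀ (γ : ℝ → M) (a b : ℝ), IsCurve I γ a b → γ a ∈ DA → γ b ∈ DB → 1 ≤ S.pathIntegral U γ a b

/-- The infimum of the path integrals over all curves from the set `Z` to the point `y`
(`∞` if there are none). -/
def infDist (U : OneForm I M) (Z : Set M) (y : M) : ℝ≥0∞ :=
  sInf {r | ∃ (γ : ℝ → M) (a b : ℝ), IsCurve I γ a b ∧ γ a ∈ Z ∧ γ b = y ∧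
    r = S.pathIntegral U γ a b}

open Classical in
/-- The function equal to `d_A - 1/2` where `d_A < 1/2`, to `1/2 - d_B` where `d_B < 1/2`, and to
`0` elsewhere, with `d_A`, `d_B` the infimal path integrals from `DA` and from `DB`. -/
def distWitness (U : OneForm I M) (DA DB : Set M) (y : M) : ℝ :=
  if S.infDist U DA y < 1 / 2 then (S.infDist U DA y).toReal - 1 / 2
  else if S.infDist U DB y < 1 / 2 then 1 / 2 - (S.infDist U DB y).toReal
  else 0

end Spacetime

end

end UFlow

end

/-! At an interior point let F(v) be the wedgedot of `U` with the covector dual to v. If `U + X` and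
`U - X` are both future-directed, then X(v) ≤ F(v) for every v (`le_pairing`). Conversely, if `U` is
future-directed, then F(v) ≤ U(v) on future causal vectors (`pairing_le_of_causal`); since F is
even, X ≤ F puts both `U + X` and `U - X` in the cone. Given that `U` is future-directed, condition
1 thus says that ψ is 1-Lipschitz for the length defined by F, and the theorem is the duality
between such functions and distances.

The conformal factor of the metric cancels in F. Hence F can be computed with the metric that
extends to the boundary, and it is continuous in charts up to the boundary.

From 1 to 2: ψ grows along a curve by at most the integral of F. A curve may lie inside the null set
where nothing is known about dψ, so the a.e. bound is first turned by Fubini into a bound along all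
short chart segments (`image_sub_le_of_ae_fderiv_le`), which controls the slopes of ψ along the
curve. That `U` is future-directed follows by averaging `U + dψ` and `U - dψ` and using continuity.

From 2 to 1: let d_A and d_B be the infimal lengths. The triangle inequality makes them Lipschitz in
charts, and condition 2 gives d_A + d_B ≥ 1. This sum bound is what makes the pieces of the explicit
ψ fit together (`toReal_ite_sub_le`). Rademacher's theorem and a first-order estimate along segments
then give dψ ≤ F almost everywhere. Curves may touch the boundary only at their ends, so they are
never joined at a boundary point: they are cut at a nearby interior point, and a limit is taken. -/

noncomputable section

namespace UFlow

/-! ### Lorentzian linear algebra: causal cones and the wedgedot pairing -/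

section LinearAlgebra

variable {V : Type*} [AddCommGroup V] [TopologicalSpace V] [Module ℝ V]

/-- A symmetric bilinear form of signature `(-,+,…,+)`. -/
structure IsLorentzForm (G : V →L[ℝ] V →L[ℝ] ℝ) : Prop where
  symm : ∀ v w, G v w = G w v
  signature : ∃ t, G t t < 0 ∧ ∀ v, G t v = 0 → v ≠ 0 → 0 < G v v

/-- The pairing of a covector `u` with the covector dual to the vector `v`. -/
def pairing [IsTopologicalAddGroup V] [ContinuousConstSMul ℝ V] (G : V →L[ℝ] V →L[ℝ] ℝ)
    (u : V →L[ℝ] ℝ) (v : V) : ℝ :=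
  max |u v| (Real.sqrt |u (ContinuousLinearMap.inverse G u) * G v v - u v ^ 2|)

theorem pairing_neg [IsTopologicalAddGroup V] [ContinuousConstSMul ℝ V]
    (G : V →L[ℝ] V →L[ℝ] ℝ) (u : V →L[ℝ] ℝ) (v : V) :
    pairing G u (-v) = pairing G u v := by
  simp [pairing]

theorem pairing_nonneg [IsTopologicalAddGroup V] [ContinuousConstSMul ℝ V]
    (G : V →L[ℝ] V →L[ℝ] ℝ) (u : V →L[ℝ] ℝ) (v : V) : 0 ≤ pairing G u v :=
  (abs_nonneg _).trans (le_max_left _ _)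

namespace IsLorentzForm

variable {G : V →L[ℝ] V →L[ℝ] ℝ}

/-- Frees the signature condition from its particular vector t. If v were not spacelike, the
combination x of T and v orthogonal to t would have non-positive square, hence vanish; pairing x = 0
with T then contradicts v ≠ 0. -/
theorem pos_of_orthogonal (hG : IsLorentzForm G) {T v : V} (hT : G T T < 0) (h : G T v = 0)
    (hv : v ≠ 0) : 0 < G v v := by
  obtain ⟨t, ht, hpos⟩ := hG.signature
  by_contra! hneg
  have hT0 : T ≠ 0 := by rintro rfl; simp at hT
  have htT : G t T ≠ 0 := fun h0 ↦ by linarith [hpos T h0 hT0]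
  set x := G t v • T - G t T • v with hx
  have htx : G t x = 0 := by simp [hx]; ring
  have hxx : G x x = G t v ^ 2 * G T T + G t T ^ 2 * G v v := by
    simp [hx, hG.symm v T, h]; ring
  have hx0 : x = 0 := by
    by_contra hne
    nlinarith [hpos x htx hne, sq_nonneg (G t v), sq_nonneg (G t T)]
  have hTx : G T x = 0 := by simp [hx0]
  have h1 : G t v * G T T = 0 := by simpa [hx, h] using hTx
  have h2 : G t v = 0 := by
    rcases mul_eq_zero.1 h1 with h | h
    · exact h
    · exact absurd h hT.ne
  rw [hx, h2, zero_smul, zero_sub, neg_eq_zero] at hx0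
  exact (smul_ne_zero htT hv) hx0

/-- A multiple of the component of v orthogonal to T has non-negative square. -/
theorem reverse_cauchySchwarz (hG : IsLorentzForm G) {T : V} (hT : G T T < 0) (v : V) :
    G T T * G v v ≤ G T v ^ 2 := by
  set w := G T T • v - G T v • T with hw
  have hTw : G T w = 0 := by simp [hw]; ring
  have hww : G w w = G T T * (G T T * G v v - G T v ^ 2) := by
    simp [hw, hG.symm v T]; ring
  have : 0 ≤ G w w := by
    by_cases h : w = 0
    · simp [h]
    · exact (hG.pos_of_orthogonal hT hTw h).le
  rw [hww] at this
  nlinarith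

/-- Otherwise a non-negative combination of t and T would be timelike and orthogonal to the causal
vector k. -/
theorem neg_of_same_cone (hG : IsLorentzForm G) {t T k : V} (ht : G t t < 0) (hT : G T T < 0)
    (htT : G t T < 0) (hk : G k k ≤ 0) (htk : G t k < 0) : G T k < 0 := by
  by_contra! h
  have hk0 : k ≠ 0 := by rintro rfl; simp at htk
  set x := G T k • t - G t k • T with hx
  have hxk : G x k = 0 := by simp [hx]; ring
  have hxx : G x x < 0 := by
    have : G x x = G T k ^ 2 * G t t + 2 * (G T k * - G t k) * G t T + G t k ^ 2 * G T T := by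
      simp [hx, hG.symm T t]; ring
    rw [this]
    have h1 : G T k ^ 2 * G t t ≤ 0 := mul_nonpos_of_nonneg_of_nonpos (sq_nonneg _) ht.le
    have h2 : (G T k * - G t k) * G t T ≤ 0 :=
      mul_nonpos_of_nonneg_of_nonpos (mul_nonneg h (by linarith)) htT.le
    have h3 : G t k ^ 2 * G T T < 0 := mul_neg_of_pos_of_neg
      ((sq_nonneg _).lt_of_ne' (pow_ne_zero 2 htk.ne)) hT
    linarith
  linarith [hG.pos_of_orthogonal hxx hxk hk0]

theorem injective (hG : IsLorentzForm G) : Function.Injective G := by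
  refine (injective_iff_map_eq_zero G).2 fun v hv ↦ ?_
  obtain ⟨t, ht, hpos⟩ := hG.signature
  by_contra hne
  have h := hpos v (by rw [hG.symm, hv]; rfl) hne
  simp [hv] at h

theorem isInvertible [IsTopologicalAddGroup V] [ContinuousSMul ℝ V] [T2Space V]
    [FiniteDimensional ℝ V] (hG : IsLorentzForm G) : G.IsInvertible := by
  have hfin : Module.finrank ℝ V = Module.finrank ℝ (V →L[ℝ] ℝ) := by
    rw [← (LinearMap.toContinuousLinearMap (𝕜 := ℝ) (E := V) (F' := ℝ)).finrank_eq]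
    exact Subspace.dual_finrank_eq.symm
  have : FiniteDimensional ℝ (V →L[ℝ] ℝ) :=
    Module.Finite.equiv (LinearMap.toContinuousLinearMap (𝕜 := ℝ) (E := V) (F' := ℝ))
  let e := LinearEquiv.ofInjectiveOfFinrankEq (G : V →ₗ[ℝ] V →L[ℝ] ℝ) hG.injective hfin
  refine ⟨e.toContinuousLinearEquiv, ?_⟩
  ext v w
  rfl

/-- Future-directed covectors have non-positive square. -/
theorem dual_nonpos (hG : IsLorentzForm G) {T s : V} (hT : G T T < 0)
    (hs : ∀ k, k ≠ 0 → G k k ≤ 0 → G T k < 0 → 0 ≤ G s k) : G s s ≤ 0 := by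
  by_contra! hpos
  set a := G T s / G T T with ha
  set w := s - a • T with hw
  have haT : a * G T T = G T s := div_mul_cancel₀ _ hT.ne
  have hTw : G T w = 0 := by simp [hw, haT]
  have hss : G s s = a ^ 2 * G T T + G w w := by
    simp [hw, hG.symm s T, ← haT]; ring
  have hww : 0 < G w w := by nlinarith [sq_nonneg a]
  -- This n makes n • T − w null and future-directed. If s = a • T + w were spacelike, then |a| < n,
  -- and s would be negative on that vector.
  set n := Real.sqrt (G w w / -G T T) with hn
  have hn0 : 0 < n := Real.sqrt_pos.2 (div_pos hww (by linarith))
  have hn2 : n ^ 2 * -G T T = G w w := by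
    rw [hn, Real.sq_sqrt (div_pos hww (by linarith)).le]
    exact div_mul_cancel₀ _ (by linarith)
  have h1 : G T (n • T - w) < 0 := by
    simp [hTw]; exact mul_neg_of_pos_of_neg hn0 hT
  have h2 : G (n • T - w) (n • T - w) = 0 := by
    simp [hTw, hG.symm w T]; linarith
  have h3 : n • T - w ≠ 0 := by intro h; simp [h] at h1
  have h4 := hs _ h3 h2.le h1
  have hsw : G s w = G w w := by
    have : s = w + a • T := by simp [hw]
    rw [this]; simp [hTw]
  have h5 : G s (n • T - w) = n * (G T T) * (a + n) := by
    simp [hsw, hG.symm s T, ← haT, ← hn2]; ring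
  rw [h5] at h4
  have h6 : a + n ≤ 0 := by
    by_contra! h
    nlinarith [mul_pos (mul_pos hn0 (neg_pos.2 hT)) h]
  have h7 : 0 < (-G T T) * ((n - a) * (n + a)) := by nlinarith
  have h8 : 0 < (n - a) * (n + a) := (mul_pos_iff_of_pos_left (by linarith)).1 h7
  nlinarith

/-- The case of a timelike covector in `le_pairing`. -/
theorem le_wedge_of_timelike (hG : IsLorentzForm G) {T s : V} {X : V →L[ℝ] ℝ} (hT : G T T < 0)
    (hs : G s s < 0) (hsT : 0 < G s T)
    (hadd : ∀ k, k ≠ 0 → G k k ≤ 0 → G T k < 0 → 0 ≤ G s k + X k)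
    (hsub : ∀ k, k ≠ 0 → G k k ≤ 0 → G T k < 0 → 0 ≤ G s k - X k) {v : V} (hv : 0 < G v v) :
    X v ≤ Real.sqrt |G s s * G v v - G s v ^ 2| := by
  set a := G s v / G s s with ha
  set w := v - a • s with hw
  have has : a * G s s = G s v := div_mul_cancel₀ _ hs.ne
  have hsw : G s w = 0 := by simp [hw, has]
  have hvv : G v v = a ^ 2 * G s s + G w w := by
    simp [hw, hG.symm v s, ← has]; ring
  have hww : 0 < G w w := by nlinarith [sq_nonneg a]
  set n := Real.sqrt (G w w / -G s s) with hn
  have hn0 : 0 < n := Real.sqrt_pos.2 (div_pos hww (by linarith))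
  have hn2 : n ^ 2 * -G s s = G w w := by
    rw [hn, Real.sq_sqrt (div_pos hww (by linarith)).le]
    exact div_mul_cancel₀ _ (by linarith)
  -- The plane of s and w contains two future null directions, ±w − n • s; the sign e treats both at
  -- once. They lie in the cone of T because −s does.
  have key : ∀ e : ℝ, e ^ 2 = 1 → 0 ≤ n * (-G s s) - e * X w + n * X s ∧
      0 ≤ n * (-G s s) + e * X w - n * X s := by
    intro e he
    set k := e • w - n • s with hk
    have h1 : G s k = n * -G s s := by simp [hk, hsw]
    have h2 : G k k = 0 := by
      simp [hk, hsw, hG.symm w s]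
      linear_combination (G w w) * he - hn2
    have h3 : G (-s) k < 0 := by simp [h1]; exact mul_neg_of_pos_of_neg hn0 hs
    have h4 : G T k < 0 :=
      hG.neg_of_same_cone (t := -s) (by simpa using hs) hT (by simpa using hsT) h2.le h3
    have h5 : k ≠ 0 := by intro h; simp [h] at h4
    have h6 := hadd k h5 h2.le h4
    have h7 := hsub k h5 h2.le h4
    have h8 : X k = e * X w - n * X s := by simp [hk]
    rw [h1, h8] at h6 h7
    exact ⟨by linarith, by linarith⟩
  have hlt : 0 < (n - a) * (n + a) := by
    have : 0 < (-G s s) * ((n - a) * (n + a)) := by nlinarith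
    exact (mul_pos_iff_of_pos_left (by linarith)).1 this
  have hna : |a| < n := by
    refine abs_lt_of_sq_lt_sq ?_ hn0.le
    nlinarith
  have hXv : X v = X w + a * X s := by
    have : v = w + a • s := by simp [hw]
    rw [this]; simp
  -- Since |a| < n, the identity 2n v = (n − a)(w − n s) + (n + a)(w + n s) writes v as a positive
  -- combination of a future and a past null vector, and X is bounded on each by `key`.
  have hXw : n * X v ≤ n * (n * -G s s) := by
    obtain ⟨k1, k2⟩ := key 1 (by norm_num)
    obtain ⟨k3, k4⟩ := key (-1) (by norm_num)
    obtain ⟨l1, l2⟩ := abs_lt.1 hna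
    rw [hXv]
    nlinarith [mul_nonneg (by linarith : 0 ≤ n + a) k3, mul_nonneg (by linarith : 0 ≤ n - a) k4,
      mul_nonneg (by linarith : 0 ≤ n + a) k1, mul_nonneg (by linarith : 0 ≤ n - a) k2]
  have hfin : G s s * G v v - G s v ^ 2 = -(n * -G s s) ^ 2 := by
    rw [hvv, ← has, ← hn2]; ring
  rw [hfin, abs_neg, abs_of_nonneg (sq_nonneg _), Real.sqrt_sq (mul_nonneg hn0.le (by linarith))]
  exact le_of_mul_le_mul_left hXw hn0

section Inverse

variable [IsTopologicalAddGroup V] [ContinuousSMul ℝ V] [T2Space V] [FiniteDimensional ℝ V]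

theorem inverse_apply_self (hG : IsLorentzForm G) (v : V) :
    ContinuousLinearMap.inverse G (G v) = v := by
  obtain ⟨e, he⟩ := hG.isInvertible
  rw [← he]
  simp

theorem exists_dual (hG : IsLorentzForm G) (u : V →L[ℝ] ℝ) : ∃ s, G s = u := by
  obtain ⟨e, he⟩ := hG.isInvertible
  exact ⟨e.symm u, by rw [← he]; simp⟩

theorem pairing_dual (hG : IsLorentzForm G) (s v : V) :
    pairing G (G s) v = max |G s v| (Real.sqrt |G s s * G v v - G s v ^ 2|) := by
  rw [pairing, hG.inverse_apply_self]

/-- On future causal vectors, the pairing with a future-directed covector is the evaluation. -/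
theorem pairing_le_of_causal (hG : IsLorentzForm G) {T : V} {u : V →L[ℝ] ℝ} (hT : G T T < 0)
    (hu : ∀ k, k ≠ 0 → G k k ≤ 0 → G T k < 0 → 0 ≤ u k) {v : V} (hv0 : v ≠ 0) (hv : G v v ≤ 0)
    (hTv : G T v < 0) : pairing G u v ≤ u v := by
  obtain ⟨s, rfl⟩ := hG.exists_dual u
  have hss := hG.dual_nonpos hT hu
  have hsv := hu v hv0 hv hTv
  rw [hG.pairing_dual]
  refine max_le (abs_of_nonneg hsv).le ?_
  -- With 0 ≤ s²v² ≤ (s·v)², the wedge term is at most s·v.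
  have h1 : G s s * G v v ≤ G s v ^ 2 := by
    rcases hss.lt_or_eq with h | h
    · exact hG.reverse_cauchySchwarz h v
    · rw [h, zero_mul]; positivity
  have h2 : 0 ≤ G s s * G v v := mul_nonneg_of_nonpos_of_nonpos hss hv
  refine Real.sqrt_le_iff.2 ⟨hsv, abs_le.2 ⟨by linarith, by nlinarith⟩⟩

/-- If `u ± X` are future-directed covectors, `X` is bounded by the pairing with `u`. -/
theorem le_pairing (hG : IsLorentzForm G) {T : V} {u X : V →L[ℝ] ℝ} (hT : G T T < 0)
    (hadd : ∀ k, k ≠ 0 → G k k ≤ 0 → G T k < 0 → 0 ≤ u k + X k)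
    (hsub : ∀ k, k ≠ 0 → G k k ≤ 0 → G T k < 0 → 0 ≤ u k - X k) (v : V) :
    X v ≤ pairing G u v := by
  obtain ⟨s, rfl⟩ := hG.exists_dual u
  rw [hG.pairing_dual]
  rcases lt_or_ge 0 (G v v) with hv | hv
  · refine le_max_of_le_right ?_
    have hss : G s s ≤ 0 := hG.dual_nonpos hT fun k h1 h2 h3 ↦ by
      linarith [hadd k h1 h2 h3, hsub k h1 h2 h3]
    have hT0 : T ≠ 0 := by rintro rfl; simp at hT
    have hsT : 0 ≤ G s T := by linarith [hadd T hT0 hT.le hT, hsub T hT0 hT.le hT]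
    -- The dual vector s may be null or zero. Subtracting ε • T makes it timelike and preserves both
    -- cone conditions; then ε tends to 0.
    have hε : ∀ ε ∈ Ioi (0 : ℝ), X v ≤ Real.sqrt
        |(G s s - 2 * ε * G s T + ε ^ 2 * G T T) * G v v - (G s v - ε * G T v) ^ 2| := by
      intro ε hε
      have hε : 0 < ε := hε
      have h1 : G (s - ε • T) (s - ε • T) = G s s - 2 * ε * G s T + ε ^ 2 * G T T := by
        simp [hG.symm T s]; ring
      have h2 : G (s - ε • T) v = G s v - ε * G T v := by simp
      rw [← h1, ← h2]
      have h3 : ε ^ 2 * G T T < 0 := mul_neg_of_pos_of_neg (by positivity) hT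
      have h4 : ∀ k, G T k < 0 → ε * G T k < 0 := fun k hk ↦ mul_neg_of_pos_of_neg hε hk
      refine hG.le_wedge_of_timelike hT ?_ ?_ ?_ ?_ hv
      · rw [h1]; nlinarith [mul_nonneg hε.le hsT]
      · simp; nlinarith
      · intro k k1 k2 k3; simp; linarith [hadd k k1 k2 k3, h4 k k3]
      · intro k k1 k2 k3; simp; linarith [hsub k k1 k2 k3, h4 k k3]
    have hcont : Continuous fun ε : ℝ ↦ Real.sqrt
        |(G s s - 2 * ε * G s T + ε ^ 2 * G T T) * G v v - (G s v - ε * G T v) ^ 2| := by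
      fun_prop
    have hlim := hcont.tendsto 0 |>.mono_left (nhdsWithin_le_nhds (s := Ioi 0))
    simpa using ge_of_tendsto hlim (Filter.eventually_of_mem self_mem_nhdsWithin hε)
  · refine le_max_of_le_left ?_
    by_cases hv0 : v = 0
    · simp [hv0]
    have hne : G T v ≠ 0 := fun h ↦ by linarith [hG.pos_of_orthogonal hT h hv0]
    rcases hne.lt_or_gt with h | h
    · exact (by linarith [hsub v hv0 hv h] : X v ≤ G s v).trans (le_abs_self _)
    · have := hadd (-v) (neg_ne_zero.2 hv0) (by simpa using hv) (by simpa using h)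
      simp only [map_neg] at this
      exact (by linarith : X v ≤ -G s v).trans (neg_le_abs _)

end Inverse

end IsLorentzForm

section Change

variable [IsTopologicalAddGroup V] [ContinuousSMul ℝ V] [T2Space V] [FiniteDimensional ℝ V]
  {W : Type*} [AddCommGroup W] [TopologicalSpace W] [Module ℝ W]
  [IsTopologicalAddGroup W] [ContinuousSMul ℝ W] [T2Space W] [FiniteDimensional ℝ W]

/-- The pairing is conformally invariant, and invariant under linear isomorphisms. -/
theorem pairing_congr {G : V →L[ℝ] V →L[ℝ] ℝ} {G' : W →L[ℝ] W →L[ℝ] ℝ} (hG : IsLorentzForm G)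
    (hG' : IsLorentzForm G') (L : W ≃L[ℝ] V) {c : ℝ}
    (h : ∀ v w, G (L v) (L w) = c * G' v w) (u : V →L[ℝ] ℝ) (w : W) :
    pairing G u (L w) = pairing G' (u ∘L (L : W →L[ℝ] V)) w := by
  obtain ⟨s, rfl⟩ := hG.exists_dual u
  obtain ⟨s, rfl⟩ := L.surjective s
  -- The factor c moves into the dual vector: the inverse metric scales by 1/c and the metric by c,
  -- so the products in the pairing do not change.
  have : G (L s) ∘L (L : W →L[ℝ] V) = G' (c • s) := by
    ext v; simp [h]
  rw [this, hG.pairing_dual, hG'.pairing_dual]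
  simp only [h, map_smul, smul_apply, smul_eq_mul]
  congr 4
  ring

end Change

end LinearAlgebra

/-! ### Growth of Lipschitz functions from derivative and slope bounds -/

section Analysis

variable {E : Type*} [NormedAddCommGroup E] [NormedSpace ℝ E] [FiniteDimensional ℝ E]
  [MeasurableSpace E] [BorelSpace E]

-- On a single segment a Lipschitz function is absolutely continuous, so its increment is the
-- integral of its derivative.
omit [FiniteDimensional ℝ E] [MeasurableSpace E] [BorelSpace E] in
theorem image_sub_le_of_ae_segment {f : E → ℝ} {B : Set E} (hB : Convex ℝ B)
    {K : NNReal} (hf : LipschitzOnWith K f B) {z v : E} {c h : ℝ} (hh : 0 ≤ h)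
    (hz : z ∈ B) (hzh : z + h • v ∈ B)
    (hae : ∀ᵐ t : ℝ, z + t • v ∈ B →
      DifferentiableAt ℝ f (z + t • v) ∧ fderiv ℝ f (z + t • v) v ≤ c) :
    f (z + h • v) - f z ≤ c * h := by
  have hseg : ∀ t ∈ Icc 0 h, z + t • v ∈ B := by
    intro t ht
    rcases hh.eq_or_lt with rfl | hpos
    · obtain rfl : t = 0 := le_antisymm ht.2 ht.1
      simpa using hz
    have := hB.add_smul_mem hz hzh (t := t / h) ⟨div_nonneg ht.1 hh, (div_le_one hpos).2 ht.2⟩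
    rwa [smul_smul, div_mul_cancel₀ _ hpos.ne'] at this
  have hline : LipschitzWith ‖v‖₊ fun t : ℝ ↦ z + t • v := by
    refine LipschitzWith.of_dist_le_mul fun s t ↦ ?_
    rw [dist_add_left, dist_eq_norm, ← sub_smul, norm_smul, dist_eq_norm, mul_comm]
    simp
  have hg : LipschitzOnWith (K * ‖v‖₊) (fun t : ℝ ↦ f (z + t • v)) (uIcc 0 h) := by
    rw [uIcc_of_le hh]
    exact hf.comp (hline.lipschitzOnWith) hseg
  have hac := hg.absolutelyContinuousOnInterval
  have hint := hac.integral_deriv_eq_sub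
  simp only [zero_smul, add_zero] at hint
  rw [← hint]
  have hle : ∫ t in (0 : ℝ)..h, deriv (fun t : ℝ ↦ f (z + t • v)) t ≤ ∫ _ in (0 : ℝ)..h, c := by
    refine intervalIntegral.integral_mono_ae_restrict hh hac.intervalIntegrable_deriv
      intervalIntegrable_const ?_
    refine (ae_restrict_iff' measurableSet_Icc).2 ?_
    filter_upwards [hae] with t ht hmem
    obtain ⟨hd, hc⟩ := ht (hseg t hmem)
    have hl : HasDerivAt (fun t : ℝ ↦ z + t • v) v t := by
      simpa using ((hasDerivAt_id t).smul_const v).const_add z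
    have := (hd.hasFDerivAt.comp_hasDerivAt t hl).deriv
    exact this.le.trans hc
  refine hle.trans_eq ?_
  simp [mul_comm]

/-- A Lipschitz function whose derivative in direction `v` is almost everywhere at most `c` grows at
most with speed `c` in direction `v`. -/
theorem image_sub_le_of_ae_fderiv_le {f : E → ℝ} {B : Set E} (hB : Convex ℝ B) (hBo : IsOpen B)
    {K : NNReal} (hf : LipschitzOnWith K f B) (μ : Measure E) [μ.IsAddHaarMeasure] {v : E} {c : ℝ}
    (hae : ∀ᵐ z ∂μ, z ∈ B → DifferentiableAt ℝ f z ∧ fderiv ℝ f z v ≤ c)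
    {z : E} {h : ℝ} (hh : 0 ≤ h) (hz : z ∈ B) (hzh : z + h • v ∈ B) :
    f (z + h • v) - f z ≤ c * h := by
  obtain ⟨N, hN, hNm, hN0⟩ := exists_measurable_superset_of_null hae
  -- Fubini: every translate of N is null, so almost every line in direction v meets N in a null set
  -- of parameters.
  have key : ∀ᵐ z ∂μ, ∀ᵐ t : ℝ, z + t • v ∉ N := by
    rw [Measure.ae_ae_comm]
    · refine Filter.Eventually.of_forall fun t ↦ ?_
      have : μ ((fun z ↦ z + t • v) ⁻¹' N) = 0 := by rw [measure_preimage_add_right, hN0]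
      exact measure_eq_zero_iff_ae_notMem.1 this
    · have : Continuous fun p : E × ℝ ↦ p.1 + p.2 • v := by fun_prop
      exact (this.measurable hNm).compl
  by_contra! hlt
  -- By continuity, a violation at one z persists on an open set, which has positive measure and
  -- therefore contains a starting point of a good line.
  have hO : IsOpen (B ∩ (fun z ↦ z + h • v) ⁻¹' B) :=
    hBo.inter (hBo.preimage (by fun_prop))
  have hcont : ContinuousOn (fun z ↦ f (z + h • v) - f z) (B ∩ (fun z ↦ z + h • v) ⁻¹' B) :=
    (hf.continuousOn.comp (by fun_prop) fun x hx ↦ hx.2).sub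
      (hf.continuousOn.mono inter_subset_left)
  have hopen := hcont.isOpen_inter_preimage hO (isOpen_Ioi (a := c * h))
  have hpos := hopen.measure_pos μ ⟨z, ⟨hz, hzh⟩, hlt⟩
  refine hpos.ne' (measure_mono_null ?_ (ae_iff.1 key))
  rintro y ⟨⟨hy, hyh⟩, hyc⟩ hgood
  refine (not_lt.2 (image_sub_le_of_ae_segment hB hf hh hy hyh ?_)) hyc
  filter_upwards [hgood] with t ht
  by_contra hbad
  exact ht (hN hbad)

/-- θ need not be differentiable: it is compared with an antiderivative of L through its right
slopes. -/
theorem ofReal_sub_le_lintegral_of_continuousOn {θ L : ℝ → ℝ} {a b : ℝ} (hab : a ≤ b)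
    (hθ : ContinuousOn θ (Icc a b)) (hL0 : ∀ t, 0 ≤ L t) {O : Set ℝ} (hO : IsOpen O)
    (hab' : Icc a b ⊆ O) (hL : ContinuousOn L O)
    (bound : ∀ t ∈ Ico a b, ∀ r, L t < r → ∃ᶠ z in 𝓝[>] t, slope θ t z < r) :
    ENNReal.ofReal (θ b - θ a) ≤ ∫⁻ t in Icc a b, ENNReal.ofReal (L t) := by
  have hcont : ContinuousOn L (Icc a b) := hL.mono hab'
  have hint : ∀ t ∈ Icc a b, IntervalIntegrable L volume a t := fun t ht ↦
    (hcont.mono (by rw [uIcc_of_le ht.1]; exact Icc_subset_Icc_right ht.2)).intervalIntegrable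
  have hderiv : ∀ t ∈ Icc a b, HasDerivAt (fun u ↦ θ a + ∫ x in a..u, L x) (L t) t := fun t ht ↦
    (intervalIntegral.integral_hasDerivAt_right (hint t ht)
      (hL.stronglyMeasurableAtFilter hO t (hab' ht)) (hL.continuousAt (hO.mem_nhds (hab' ht)))
      ).const_add _
  have := image_le_of_liminf_slope_right_le_deriv_boundary hθ
    (B := fun u ↦ θ a + ∫ x in a..u, L x) (B' := L) (by simp)
    (fun t ht ↦ (hderiv t ht).continuousAt.continuousWithinAt)
    (fun t ht ↦ (hderiv t (Ico_subset_Icc_self ht)).hasDerivWithinAt) bound (right_mem_Icc.2 hab)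
  have h2 : θ b - θ a ≤ ∫ x in Icc a b, L x := by
    rw [integral_Icc_eq_integral_Ioc, ← intervalIntegral.integral_of_le hab]; linarith
  refine (ENNReal.ofReal_le_ofReal h2).trans_eq ?_
  exact ofReal_integral_eq_lintegral_ofReal hcont.integrableOn_Icc (Filter.Eventually.of_forall hL0)

/-- A continuous function whose upper right slopes are bounded by a continuous function, with
finitely many exceptional points, grows at most by the integral of the bound. -/
theorem ofReal_sub_le_lintegral {θ L : ℝ → ℝ} (hL0 : ∀ t, 0 ≤ L t) (s : Finset ℝ) {a b : ℝ}
    (hab : a < b) (hθ : ContinuousOn θ (Icc a b))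
    (hL : ∀ t ∈ Ioo a b, t ∉ s → ContinuousAt L t)
    (bound : ∀ t ∈ Ioo a b, t ∉ s → ∀ r, L t < r → ∃ᶠ z in 𝓝[>] t, slope θ t z < r) :
    ENNReal.ofReal (θ b - θ a) ≤ ∫⁻ t in Ioo a b, ENNReal.ofReal (L t) := by
  induction s using Finset.induction_on generalizing a b with
  | empty =>
    simp only [Finset.notMem_empty, not_false_eq_true, true_imp_iff] at hL bound
    -- L may blow up at the ends, so the interval is shrunk by δ, and continuity of θ recovers the
    -- increment.
    have hev : ∀ᶠ δ in 𝓝[>] (0 : ℝ), ENNReal.ofReal (θ (b - δ) - θ (a + δ)) ≤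
        ∫⁻ t in Ioo a b, ENNReal.ofReal (L t) := by
      have : Ioo 0 ((b - a) / 2) ∈ 𝓝[>] (0 : ℝ) := Ioo_mem_nhdsGT (by linarith)
      filter_upwards [this] with δ hδ
      have h1 : Icc (a + δ) (b - δ) ⊆ Ioo a b := fun t ht ↦
        ⟨by linarith [ht.1, hδ.1], by linarith [ht.2, hδ.1]⟩
      refine (ofReal_sub_le_lintegral_of_continuousOn (by linarith [hδ.2])
        (hθ.mono (h1.trans Ioo_subset_Icc_self)) hL0 isOpen_Ioo h1
        (fun t ht ↦ (hL t ht).continuousWithinAt)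
        (fun t ht ↦ bound t (h1 (Ico_subset_Icc_self ht)))).trans ?_
      exact lintegral_mono_set h1
    have hta : Filter.Tendsto (fun δ : ℝ ↦ θ (a + δ)) (𝓝[>] 0) (𝓝 (θ a)) := by
      refine (hθ a (left_mem_Icc.2 hab.le)).tendsto.comp (tendsto_nhdsWithin_iff.2 ⟨?_, ?_⟩)
      · have : Filter.Tendsto (fun δ : ℝ ↦ a + δ) (𝓝 0) (𝓝 (a + 0)) := by
          exact (continuous_const.add continuous_id).tendsto 0
        rw [add_zero] at this
        exact this.mono_left nhdsWithin_le_nhds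
      · filter_upwards [Ioo_mem_nhdsGT (sub_pos.2 hab)] with δ hδ
        exact ⟨by linarith [hδ.1], by linarith [hδ.2]⟩
    have htb : Filter.Tendsto (fun δ : ℝ ↦ θ (b - δ)) (𝓝[>] 0) (𝓝 (θ b)) := by
      refine (hθ b (right_mem_Icc.2 hab.le)).tendsto.comp (tendsto_nhdsWithin_iff.2 ⟨?_, ?_⟩)
      · have : Filter.Tendsto (fun δ : ℝ ↦ b - δ) (𝓝 0) (𝓝 (b - 0)) := by
          exact (continuous_const.sub continuous_id).tendsto 0
        rw [sub_zero] at this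
        exact this.mono_left nhdsWithin_le_nhds
      · filter_upwards [Ioo_mem_nhdsGT (sub_pos.2 hab)] with δ hδ
        exact ⟨by linarith [hδ.2], by linarith [hδ.1]⟩
    exact le_of_tendsto ((ENNReal.continuous_ofReal.tendsto _).comp (htb.sub hta)) hev
  | insert c s _ ih =>
    by_cases hc : c ∈ Ioo a b
    · have hsub1 : Ioo a c ⊆ Ioo a b := Ioo_subset_Ioo_right hc.2.le
      have hsub2 : Ioo c b ⊆ Ioo a b := Ioo_subset_Ioo_left hc.1.le
      have h1 := ih hc.1 (hθ.mono (Icc_subset_Icc_right hc.2.le))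
        (fun t ht hts ↦ hL t (hsub1 ht) (by simp [hts, ht.2.ne]))
        (fun t ht hts ↦ bound t (hsub1 ht) (by simp [hts, ht.2.ne]))
      have h2 := ih hc.2 (hθ.mono (Icc_subset_Icc_left hc.1.le))
        (fun t ht hts ↦ hL t (hsub2 ht) (by simp [hts, ht.1.ne']))
        (fun t ht hts ↦ bound t (hsub2 ht) (by simp [hts, ht.1.ne']))
      have hdisj : Disjoint (Ioo a c) (Ioo c b) :=
        Set.disjoint_left.2 fun t ht ht' ↦ lt_asymm ht.2 ht'.1
      calc ENNReal.ofReal (θ b - θ a)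
          ≤ ENNReal.ofReal (θ c - θ a) + ENNReal.ofReal (θ b - θ c) := by
            refine le_trans (ENNReal.ofReal_le_ofReal (by linarith)) ENNReal.ofReal_add_le
        _ ≤ _ := add_le_add h1 h2
        _ = ∫⁻ t in Ioo a c ∪ Ioo c b, ENNReal.ofReal (L t) :=
            (lintegral_union measurableSet_Ioo hdisj).symm
        _ ≤ _ := lintegral_mono_set (union_subset hsub1 hsub2)
    · refine ih hab hθ (fun t ht hts ↦ hL t ht ?_) (fun t ht hts ↦ bound t ht ?_) <;>
      · rw [Finset.mem_insert, not_or]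
        exact ⟨fun h ↦ hc (h ▸ ht), hts⟩

end Analysis

/-! ### Metric, covectors and differentials in charts -/

section Coordinates

variable {D : ℕ} {H : Type*} [TopologicalSpace H]
  {I : ModelWithCorners ℝ (EuclideanSpace ℝ (Fin D)) H}
  {M : Type*} [TopologicalSpace M] [ChartedSpace H M]

instance (x : M) : FiniteDimensional ℝ (TangentSpace I x) :=
  inferInstanceAs (FiniteDimensional ℝ (EuclideanSpace ℝ (Fin D)))

instance (x : M) : T2Space (TangentSpace I x) :=
  inferInstanceAs (T2Space (EuclideanSpace ℝ (Fin D)))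

theorem IsLorentzianOn.isLorentzForm [IsManifold I ∞ M] {g : BilinField I M} {s : Set M}
    (h : IsLorentzianOn I g s) {x : M} (hx : x ∈ s) : IsLorentzForm (g x) :=
  ⟨h.symm x hx, h.signature x hx⟩

variable [IsManifold I ∞ M]

variable (I) in
/-- The vector at `x` with given components in the chart at `x₀`. -/
def frame (x₀ x : M) : EuclideanSpace ℝ (Fin D) →L[ℝ] TangentSpace I x :=
  (trivializationAt (EuclideanSpace ℝ (Fin D)) (TangentSpace I) x₀).symmL ℝ x

variable (I) in
/-- `frame` as an equivalence. -/
def frameEquiv {x₀ x : M} (hx : x ∈ (chartAt H x₀).source) :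
    EuclideanSpace ℝ (Fin D) ≃L[ℝ] TangentSpace I x :=
  ContinuousLinearEquiv.equivOfInverse (frame I x₀ x)
    ((trivializationAt (EuclideanSpace ℝ (Fin D)) (TangentSpace I) x₀).continuousLinearMapAt ℝ x)
    (fun v ↦ (trivializationAt (EuclideanSpace ℝ (Fin D)) (TangentSpace I)
      x₀).continuousLinearMapAt_symmL hx v)
    (fun w ↦ (trivializationAt (EuclideanSpace ℝ (Fin D)) (TangentSpace I)
      x₀).symmL_continuousLinearMapAt hx w)

theorem frameEquiv_apply {x₀ x : M} (hx : x ∈ (chartAt H x₀).source)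
    (v : EuclideanSpace ℝ (Fin D)) : frameEquiv I hx v = frame I x₀ x v :=
  rfl

theorem frame_mfderiv {x₀ x : M} (hx : x ∈ (chartAt H x₀).source) (w : TangentSpace I x) :
    frame I x₀ x (mfderiv I 𝓘(ℝ, EuclideanSpace ℝ (Fin D)) (extChartAt I x₀) x w) = w := by
  rw [← TangentBundle.continuousLinearMapAt_trivializationAt hx]
  exact (trivializationAt (EuclideanSpace ℝ (Fin D)) (TangentSpace I) x₀).symmL_continuousLinearMapAt
    hx w

theorem mfderiv_frame {x₀ x : M} (hx : x ∈ (chartAt H x₀).source) (v : EuclideanSpace ℝ (Fin D)) :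
    mfderiv I 𝓘(ℝ, EuclideanSpace ℝ (Fin D)) (extChartAt I x₀) x (frame I x₀ x v) = v := by
  rw [← TangentBundle.continuousLinearMapAt_trivializationAt hx]
  exact (trivializationAt (EuclideanSpace ℝ (Fin D)) (TangentSpace I) x₀).continuousLinearMapAt_symmL
    hx v

theorem continuousOn_frame (x₀ : M) (v : EuclideanSpace ℝ (Fin D)) :
    ContinuousOn (fun x : M ↦ Bundle.TotalSpace.mk' (EuclideanSpace ℝ (Fin D))
      (E := fun x : M ↦ TangentSpace I x) x (frame I x₀ x v)) (chartAt H x₀).source := by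
  set e := trivializationAt (EuclideanSpace ℝ (Fin D)) (TangentSpace I : M → Type _) x₀
  have h : ContinuousOn (fun x : M ↦ e.toOpenPartialHomeomorph.symm (x, v)) (chartAt H x₀).source :=
    e.toOpenPartialHomeomorph.continuousOn_symm.comp (by fun_prop) fun x hx ↦ by
      rw [e.target_eq]; exact ⟨hx, mem_univ _⟩
  refine h.congr fun x hx ↦ ?_
  have := e.mk_symm (b := x) hx v
  rw [← e.symmL_apply (R := ℝ) hx] at this
  exact this

/-- The components of a covector at `x` in the chart at `x₀`. -/
def coordCovector (U : OneForm I M) (x₀ x : M) : EuclideanSpace ℝ (Fin D) →L[ℝ] ℝ :=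
  U x ∘L frame I x₀ x

/-- The components of a bilinear form at `x` in the chart at `x₀`. -/
def coordForm (g : BilinField I M) (x₀ x : M) :
    EuclideanSpace ℝ (Fin D) →L[ℝ] EuclideanSpace ℝ (Fin D) →L[ℝ] ℝ :=
  ContinuousLinearMap.precomp ℝ (frame I x₀ x) ∘L g x ∘L frame I x₀ x

theorem continuousOn_coordForm {g : BilinField I M} {s : Set M} (hg : IsLorentzianOn I g s)
    (x₀ : M) : ContinuousOn (coordForm g x₀) ((chartAt H x₀).source ∩ s) := by
  refine continuousOn_clm_apply.2 fun v ↦ continuousOn_clm_apply.2 fun w ↦ ?_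
  have h := ContinuousOn.clm_bundle_apply₂ (F₁ := EuclideanSpace ℝ (Fin D))
    (F₂ := EuclideanSpace ℝ (Fin D)) (F₃ := ℝ) (E₁ := fun x : M ↦ TangentSpace I x)
    (E₂ := fun x : M ↦ TangentSpace I x) (E₃ := Bundle.Trivial M ℝ)
    (hg.continuousOn.mono inter_subset_right) ((continuousOn_frame x₀ v).mono inter_subset_left)
    ((continuousOn_frame x₀ w).mono inter_subset_left)
  exact ((Bundle.Trivial.homeomorphProd M ℝ).continuous.comp_continuousOn h).snd

theorem continuousOn_coordCovector {U : OneForm I M} (hU : IsContinuousOneForm I U) (x₀ : M) :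
    ContinuousOn (coordCovector U x₀) (chartAt H x₀).source := by
  refine continuousOn_clm_apply.2 fun v ↦ ?_
  have h := ContinuousOn.clm_bundle_apply (F₁ := EuclideanSpace ℝ (Fin D))
    (F₂ := ℝ) (E₁ := fun x : M ↦ TangentSpace I x) (E₂ := Bundle.Trivial M ℝ)
    (hU.continuousOn) (continuousOn_frame x₀ v)
  exact ((Bundle.Trivial.homeomorphProd M ℝ).continuous.comp_continuousOn h).snd

theorem coordForm_isLorentzForm {g : BilinField I M} {s : Set M} (hg : IsLorentzianOn I g s)
    {x₀ x : M} (hx : x ∈ (chartAt H x₀).source) (hs : x ∈ s) :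
    IsLorentzForm (coordForm g x₀ x) := by
  refine ⟨fun v w ↦ hg.symm x hs _ _, ?_⟩
  obtain ⟨t, ht, hpos⟩ := hg.signature x hs
  obtain ⟨t, rfl⟩ := (frameEquiv I hx).surjective t
  refine ⟨t, ht, fun v hv hv0 ↦ hpos _ hv ?_⟩
  exact (frameEquiv I hx).map_ne_zero_iff.2 hv0

namespace Spacetime

variable (S : Spacetime I M)

/-- The metric on all of `M` representing the extended causal structure. -/
def extMetric : BilinField I M := S.causal_extends.choose

theorem isLorentzianOn_extMetric : IsLorentzianOn I S.extMetric univ :=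
  S.causal_extends.choose_spec.1

theorem conformal {x : M} (hx : x ∈ I.interior M) :
    ∃ c : ℝ, 0 < c ∧ ∀ v w : TangentSpace I x, S.g x v w = c * S.extMetric x v w :=
  S.causal_extends.choose_spec.2 x hx

/-- The wedgedot pairing of `U` with vectors, in the coordinates of the chart at `x₀`. -/
def coordPairing (U : OneForm I M) (x₀ x : M) (v : EuclideanSpace ℝ (Fin D)) : ℝ :=
  pairing (coordForm S.extMetric x₀ x) (coordCovector U x₀ x) v

theorem wedgedot_eq_pairing {x : M} (hx : x ∈ I.interior M) (W : TangentSpace I x →L[ℝ] ℝ)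
    (v : TangentSpace I x) : S.wedgedot x W (S.g x v) = pairing (S.g x) W v := by
  have hG := S.lorentzian.isLorentzForm hx
  simp only [wedgedot, wedgeNorm, dot, sharp, pairing, hG.inverse_apply_self]

/-- Conformal invariance replaces the metric, given only in the interior, by the extended one. -/
theorem wedgedot_eq_coordPairing (U : OneForm I M) {x₀ x : M} (hx : x ∈ (chartAt H x₀).source)
    (hi : x ∈ I.interior M) (v : EuclideanSpace ℝ (Fin D)) :
    S.wedgedot x (U x) (S.g x (frame I x₀ x v)) = S.coordPairing U x₀ x v := by
  obtain ⟨c, -, hc⟩ := S.conformal hi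
  rw [S.wedgedot_eq_pairing hi, coordPairing, ← frameEquiv_apply hx,
    pairing_congr (S.lorentzian.isLorentzForm hi)
      (coordForm_isLorentzForm S.isLorentzianOn_extMetric hx (mem_univ x)) (frameEquiv I hx)
      (c := c) (fun v w ↦ hc _ _)]
  rfl

/-- Covers boundary points and is joint in point and vector. Inversion of linear maps is continuous
at invertible ones. -/
theorem continuousOn_coordPairing {U : OneForm I M} (hU : IsContinuousOneForm I U) (x₀ : M) :
    ContinuousOn (fun p : M × EuclideanSpace ℝ (Fin D) ↦ S.coordPairing U x₀ p.1 p.2)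
      ((chartAt H x₀).source ×ˢ univ) := by
  have hfst : MapsTo (Prod.fst : M × EuclideanSpace ℝ (Fin D) → M)
      ((chartAt H x₀).source ×ˢ univ) (chartAt H x₀).source := fun p hp ↦ hp.1
  have hG : ContinuousOn (fun p : M × EuclideanSpace ℝ (Fin D) ↦ coordForm S.extMetric x₀ p.1)
      ((chartAt H x₀).source ×ˢ univ) :=
    (continuousOn_coordForm S.isLorentzianOn_extMetric x₀).comp continuousOn_fst
      fun p hp ↦ ⟨hp.1, mem_univ _⟩
  have hu : ContinuousOn (fun p : M × EuclideanSpace ℝ (Fin D) ↦ coordCovector U x₀ p.1)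
      ((chartAt H x₀).source ×ˢ univ) :=
    (continuousOn_coordCovector hU x₀).comp continuousOn_fst hfst
  have hinv : ContinuousOn (fun p : M × EuclideanSpace ℝ (Fin D) ↦
      ContinuousLinearMap.inverse (coordForm S.extMetric x₀ p.1))
      ((chartAt H x₀).source ×ˢ univ) := by
    intro p hp
    obtain ⟨e, he⟩ :=
      (coordForm_isLorentzForm S.isLorentzianOn_extMetric hp.1 (mem_univ p.1)).isInvertible
    have h := (contDiffAt_map_inverse (𝕜 := ℝ) (n := 0) e).continuousAt
    rw [he] at h
    exact ContinuousAt.comp_continuousWithinAt (f := fun p : M × EuclideanSpace ℝ (Fin D) ↦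
      coordForm S.extMetric x₀ p.1) h (hG p hp)
  have huv := hu.clm_apply continuousOn_snd
  exact huv.abs.sup ((((hu.clm_apply (hinv.clm_apply hu)).mul
    ((hG.clm_apply continuousOn_snd).clm_apply continuousOn_snd)).sub (huv.pow 2)).abs.sqrt)

theorem coordPairing_neg (U : OneForm I M) (x₀ x : M) (v : EuclideanSpace ℝ (Fin D)) :
    S.coordPairing U x₀ x (-v) = S.coordPairing U x₀ x v :=
  pairing_neg _ _ _

theorem coordPairing_nonneg (U : OneForm I M) (x₀ x : M) (v : EuclideanSpace ℝ (Fin D)) :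
    0 ≤ S.coordPairing U x₀ x v :=
  pairing_nonneg _ _ _

end Spacetime

theorem velocity_eq_frame {γ : ℝ → M} {t : ℝ} {x₀ : M} (ht : γ t ∈ (chartAt H x₀).source)
    (hγ : MDifferentiableAt 𝓘(ℝ, ℝ) I γ t) :
    velocity I γ t = frame I x₀ (γ t) (deriv (extChartAt I x₀ ∘ γ) t) := by
  have h := mfderiv_comp t (mdifferentiableAt_extChartAt ht) hγ
  have h2 : deriv (extChartAt I x₀ ∘ γ) t =
      mfderiv I 𝓘(ℝ, EuclideanSpace ℝ (Fin D)) (extChartAt I x₀) (γ t) (velocity I γ t) := by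
    rw [← fderiv_apply_one_eq_deriv, ← mfderiv_eq_fderiv, h]
    rfl
  rw [h2]
  exact (frame_mfderiv ht _).symm

theorem mem_interior_iff {x₀ x : M} (hx : x ∈ (chartAt H x₀).source) :
    x ∈ I.interior M ↔ extChartAt I x₀ x ∈ interior (extChartAt I x₀).target :=
  I.isInteriorPoint_iff_of_mem_atlas (n := ∞) (by simp) (chart_mem_atlas H x₀) hx

theorem mem_interior_iff_range {x₀ x : M} (hx : x ∈ (chartAt H x₀).source) :
    x ∈ I.interior M ↔ extChartAt I x₀ x ∈ interior (range I) := by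
  refine (mem_interior_iff hx).trans ⟨fun h ↦ ?_, fun h ↦ ?_⟩
  · exact interior_mono (extChartAt_target_subset_range x₀) h
  · exact (chartAt H x₀).mem_interior_extend_target ((chartAt H x₀).map_source hx) h

theorem mdifferentiableAt_iff_coord {ψ : M → ℝ} {x₀ x : M} (hx : x ∈ (chartAt H x₀).source)
    (hi : x ∈ I.interior M) (hψ : ContinuousAt ψ x) :
    MDifferentiableAt I 𝓘(ℝ, ℝ) ψ x ↔
      DifferentiableAt ℝ (ψ ∘ (extChartAt I x₀).symm) (extChartAt I x₀ x) := by
  rw [mdifferentiableAt_iff_of_mem_source (x := x₀) (y := ψ x) hx (mem_chart_source ℝ _)]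
  simp only [hψ, true_and, mfld_simps]
  have := mem_interior_iff_mem_nhds.1 ((mem_interior_iff_range hx).1 hi)
  exact ⟨fun h ↦ h.differentiableAt this, fun h ↦ h.differentiableWithinAt⟩

theorem diff_frame {ψ : M → ℝ} {x₀ x : M} (hx : x ∈ (chartAt H x₀).source)
    (hi : x ∈ I.interior M) (hψ : MDifferentiableAt I 𝓘(ℝ, ℝ) ψ x)
    (v : EuclideanSpace ℝ (Fin D)) :
    diff I ψ x (frame I x₀ x v) = fderiv ℝ (ψ ∘ (extChartAt I x₀).symm) (extChartAt I x₀ x) v := by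
  have hd := (mdifferentiableAt_iff_coord hx hi hψ.continuousAt).1 hψ
  have heq : ψ =ᶠ[𝓝 x] (ψ ∘ (extChartAt I x₀).symm) ∘ extChartAt I x₀ := by
    filter_upwards [(chartAt H x₀).open_source.mem_nhds hx] with y hy
    have h := (extChartAt I x₀).left_inv (x := y) (by rwa [extChartAt_source])
    simp only [Function.comp_apply, h]
  rw [diff, heq.mfderiv_eq, mfderiv_comp x hd.mdifferentiableAt (mdifferentiableAt_extChartAt hx),
    mfderiv_eq_fderiv]
  change fderiv ℝ _ _ (mfderiv I _ (extChartAt I x₀) x (frame I x₀ x v)) = _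
  rw [mfderiv_frame hx]
  rfl

end Coordinates

/-! ### Operations on curves and the triangle inequality -/

section Curves

variable {D : ℕ} {H : Type*} [TopologicalSpace H]
  {I : ModelWithCorners ℝ (EuclideanSpace ℝ (Fin D)) H}
  {M : Type*} [TopologicalSpace M] [ChartedSpace H M]

theorem IsCurve.restrict {γ : ℝ → M} {a b c : ℝ} (h : IsCurve I γ a b) (hac : a < c)
    (hcb : c ≤ b) : IsCurve I γ a c where
  lt := hac
  continuousOn := h.continuousOn.mono (Icc_subset_Icc_right hcb)
  mapsTo := h.mapsTo.mono_left (Ioo_subset_Ioo_right hcb)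
  piecewise := h.piecewise.imp fun _ hs t ht ↦ hs t (Ioo_subset_Ioo_right hcb ht)

theorem IsCurve.ae_mdifferentiableAt {γ : ℝ → M} {a b : ℝ} (h : IsCurve I γ a b) :
    ∀ᵐ t : ℝ, t ∈ Ioo a b → MDifferentiableAt 𝓘(ℝ, ℝ) I γ t := by
  obtain ⟨s, hs⟩ := h.piecewise
  filter_upwards [s.finite_toSet.countable.ae_notMem volume] with t ht htab
  exact (hs t htab ht).mdifferentiableAt (by simp)

theorem IsCurve.shift {γ : ℝ → M} {a b : ℝ} (h : IsCurve I γ a b) (c : ℝ) :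
    IsCurve I (fun t ↦ γ (t + c)) (a - c) (b - c) where
  lt := by linarith [h.lt]
  continuousOn := h.continuousOn.comp (by fun_prop)
    fun t ht ↦ ⟨by linarith [ht.1], by linarith [ht.2]⟩
  mapsTo := fun t ht ↦ h.mapsTo ⟨by linarith [ht.1], by linarith [ht.2]⟩
  piecewise := by
    obtain ⟨s, hs⟩ := h.piecewise
    refine ⟨s.image (· - c), fun t ht hts ↦ ?_⟩
    have h1 : ContMDiffAt 𝓘(ℝ, ℝ) I 1 γ (t + c) :=
      hs _ ⟨by linarith [ht.1], by linarith [ht.2]⟩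
        fun h ↦ hts (Finset.mem_image.2 ⟨t + c, h, by ring⟩)
    exact ContMDiffAt.comp (I' := 𝓘(ℝ, ℝ)) (g := γ) (f := fun t : ℝ ↦ t + c) t h1
      (by fun_prop : ContDiffAt ℝ 1 (fun t : ℝ ↦ t + c) t).contMDiffAt

theorem IsCurve.reverse {γ : ℝ → M} {a b : ℝ} (h : IsCurve I γ a b) :
    IsCurve I (fun t ↦ γ (-t)) (-b) (-a) where
  lt := by linarith [h.lt]
  continuousOn := h.continuousOn.comp (by fun_prop)
    fun t ht ↦ ⟨by linarith [ht.2], by linarith [ht.1]⟩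
  mapsTo := fun t ht ↦ h.mapsTo ⟨by linarith [ht.2], by linarith [ht.1]⟩
  piecewise := by
    obtain ⟨s, hs⟩ := h.piecewise
    refine ⟨s.image (- ·), fun t ht hts ↦ ?_⟩
    have h1 : ContMDiffAt 𝓘(ℝ, ℝ) I 1 γ (-t) :=
      hs _ ⟨by linarith [ht.2], by linarith [ht.1]⟩
        fun h ↦ hts (Finset.mem_image.2 ⟨-t, h, by ring⟩)
    exact ContMDiffAt.comp (I' := 𝓘(ℝ, ℝ)) (g := γ) (f := fun t : ℝ ↦ -t) t h1
      (by fun_prop : ContDiffAt ℝ 1 (fun t : ℝ ↦ -t) t).contMDiffAt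

open Classical in
theorem IsCurve.concat {γ₁ γ₂ : ℝ → M} {a b c : ℝ} (h₁ : IsCurve I γ₁ a b)
    (h₂ : IsCurve I γ₂ b c) (hb : γ₁ b = γ₂ b) (hi : γ₁ b ∈ I.interior M) :
    IsCurve I (fun t ↦ if t ≤ b then γ₁ t else γ₂ t) a c where
  lt := h₁.lt.trans h₂.lt
  continuousOn := by
    refine ContinuousOn.if ?_ ?_ ?_
    · rintro t ⟨-, ht⟩
      change t ∈ frontier (Iic b) at ht
      have : t = b := by simpa [frontier_Iic] using ht
      rw [this, hb]
    · refine h₁.continuousOn.mono fun t ht ↦ ⟨ht.1.1, ?_⟩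
      have : t ∈ closure (Iic b) := ht.2
      rwa [closure_Iic] at this
    · refine h₂.continuousOn.mono fun t ht ↦ ⟨?_, ht.1.2⟩
      have : t ∈ closure (Iic b)ᶜ := ht.2
      rwa [compl_Iic, closure_Ioi] at this
  mapsTo := by
    intro t ht
    dsimp only
    split_ifs with h
    · rcases h.lt_or_eq with h | rfl
      · exact h₁.mapsTo ⟨ht.1, h⟩
      · exact hi
    · exact h₂.mapsTo ⟨not_le.1 h, ht.2⟩
  piecewise := by
    obtain ⟨s₁, hs₁⟩ := h₁.piecewise
    obtain ⟨s₂, hs₂⟩ := h₂.piecewise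
    -- The velocity may jump at the junction, so b becomes an exceptional parameter.
    refine ⟨insert b (s₁ ∪ s₂), fun t ht hts ↦ ?_⟩
    simp only [Finset.mem_insert, Finset.mem_union, not_or] at hts
    rcases lt_or_gt_of_ne hts.1 with h | h
    · refine (hs₁ t ⟨ht.1, h⟩ hts.2.1).congr_of_eventuallyEq ?_
      filter_upwards [Iio_mem_nhds h] with u hu
      exact if_pos hu.le
    · refine (hs₂ t ⟨h, ht.2⟩ hts.2.2).congr_of_eventuallyEq ?_
      filter_upwards [Ioi_mem_nhds h] with u hu
      exact if_neg hu.not_ge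

variable [IsManifold I ∞ M]

namespace Spacetime

variable (S : Spacetime I M)

/-- The integrand of the path integral. -/
def speed (U : OneForm I M) (γ : ℝ → M) (t : ℝ) : ℝ :=
  S.wedgedot (γ t) (U (γ t)) (S.g (γ t) (velocity I γ t))

theorem pathIntegral_eq (U : OneForm I M) (γ : ℝ → M) (a b : ℝ) :
    S.pathIntegral U γ a b = ∫⁻ t in Ioo a b, ENNReal.ofReal (S.speed U γ t) :=
  rfl

theorem speed_nonneg (U : OneForm I M) (γ : ℝ → M) (t : ℝ) : 0 ≤ S.speed U γ t :=
  (abs_nonneg _).trans (le_max_left _ _)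

/-- Allows velocities in the formally different tangent spaces at x and y to be compared in the
common model space. -/
theorem wedgedot_congr (U : OneForm I M) {x y : M} (hxy : x = y) {v : TangentSpace I x}
    {w : TangentSpace I y} (hvw : (v : EuclideanSpace ℝ (Fin D)) = w) :
    S.wedgedot x (U x) (S.g x v) = S.wedgedot y (U y) (S.g y w) := by
  subst hxy
  have : v = w := hvw
  rw [this]

theorem wedgedot_neg (x : M) (W X : TangentSpace I x →L[ℝ] ℝ) :
    S.wedgedot x W (-X) = S.wedgedot x W X := by
  simp [wedgedot, wedgeNorm, dot, sharp]

theorem speed_congr (U : OneForm I M) {γ γ' : ℝ → M} {t : ℝ} (h : γ =ᶠ[𝓝 t] γ') :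
    S.speed U γ t = S.speed U γ' t := by
  refine S.wedgedot_congr U h.eq_of_nhds ?_
  have := h.mfderiv_eq (I := 𝓘(ℝ, ℝ)) (I' := I)
  exact congrArg (fun L : ℝ →L[ℝ] EuclideanSpace ℝ (Fin D) ↦ L 1) this

theorem speed_shift (U : OneForm I M) {γ : ℝ → M} {t c : ℝ}
    (h : MDifferentiableAt 𝓘(ℝ, ℝ) I γ (t + c)) :
    S.speed U (fun t ↦ γ (t + c)) t = S.speed U γ (t + c) := by
  have hd : HasDerivAt (fun t : ℝ ↦ t + c) 1 t := (hasDerivAt_id t).add_const c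
  have := mfderiv_comp (I := 𝓘(ℝ, ℝ)) (I' := 𝓘(ℝ, ℝ)) (I'' := I) (g := γ)
    (f := fun t : ℝ ↦ t + c) t h hd.differentiableAt.mdifferentiableAt
  refine S.wedgedot_congr U rfl ?_
  change mfderiv 𝓘(ℝ, ℝ) I (γ ∘ fun t : ℝ ↦ t + c) t (1 : ℝ) = mfderiv 𝓘(ℝ, ℝ) I γ (t + c) (1 : ℝ)
  rw [this, mfderiv_eq_fderiv]
  change mfderiv 𝓘(ℝ, ℝ) I γ (t + c) (fderiv ℝ (fun t : ℝ ↦ t + c) t (1 : ℝ)) = _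
  rw [fderiv_apply_one_eq_deriv, hd.deriv]

theorem speed_reverse (U : OneForm I M) {γ : ℝ → M} {t : ℝ}
    (h : MDifferentiableAt 𝓘(ℝ, ℝ) I γ (-t)) :
    S.speed U (fun t ↦ γ (-t)) t = S.speed U γ (-t) := by
  have hd : HasDerivAt (fun t : ℝ ↦ -t) (-1) t := (hasDerivAt_id t).neg
  have := mfderiv_comp (I := 𝓘(ℝ, ℝ)) (I' := 𝓘(ℝ, ℝ)) (I'' := I) (g := γ)
    (f := fun t : ℝ ↦ -t) t h hd.differentiableAt.mdifferentiableAt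
  have hv : velocity I (fun t ↦ γ (-t)) t = -velocity I γ (-t) := by
    change mfderiv 𝓘(ℝ, ℝ) I (γ ∘ fun t : ℝ ↦ -t) t (1 : ℝ) = -(mfderiv 𝓘(ℝ, ℝ) I γ (-t) (1 : ℝ))
    rw [this, mfderiv_eq_fderiv]
    change mfderiv 𝓘(ℝ, ℝ) I γ (-t) (fderiv ℝ (fun t : ℝ ↦ -t) t (1 : ℝ)) = _
    rw [fderiv_apply_one_eq_deriv, hd.deriv]
    exact map_neg (mfderiv 𝓘(ℝ, ℝ) I γ (-t)) (1 : ℝ)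
  rw [speed, hv, map_neg, wedgedot_neg]
  rfl

theorem pathIntegral_restrict_le (U : OneForm I M) (γ : ℝ → M) {a b c : ℝ} (hcb : c ≤ b) :
    S.pathIntegral U γ a c ≤ S.pathIntegral U γ a b :=
  lintegral_mono_set (Ioo_subset_Ioo_right hcb)

theorem pathIntegral_shift (U : OneForm I M) {γ : ℝ → M} {a b : ℝ} (h : IsCurve I γ a b) (c : ℝ) :
    S.pathIntegral U (fun t ↦ γ (t + c)) (a - c) (b - c) = S.pathIntegral U γ a b := by
  have hmp := (measurePreserving_add_right (volume : Measure ℝ) c).setLIntegral_comp_preimage_emb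
    (measurableEmbedding_addRight c) (fun t ↦ ENNReal.ofReal (S.speed U γ t)) (Ioo a b)
  rw [pathIntegral_eq, pathIntegral_eq, ← hmp]
  have hpre : (fun t ↦ t + c) ⁻¹' Ioo a b = Ioo (a - c) (b - c) := by simp
  rw [hpre]
  refine setLIntegral_congr_fun_ae measurableSet_Ioo ?_
  have hae := (measurePreserving_add_right (volume : Measure ℝ) c).quasiMeasurePreserving.ae
    h.ae_mdifferentiableAt
  filter_upwards [hae] with t ht htm
  rw [S.speed_shift U (ht ⟨by linarith [htm.1], by linarith [htm.2]⟩)]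

theorem pathIntegral_reverse (U : OneForm I M) {γ : ℝ → M} {a b : ℝ} (h : IsCurve I γ a b) :
    S.pathIntegral U (fun t ↦ γ (-t)) (-b) (-a) = S.pathIntegral U γ a b := by
  have hmp := (Measure.measurePreserving_neg (volume : Measure ℝ)).setLIntegral_comp_preimage_emb
    (MeasurableEquiv.neg ℝ).measurableEmbedding (fun t ↦ ENNReal.ofReal (S.speed U γ t)) (Ioo a b)
  rw [pathIntegral_eq, pathIntegral_eq, ← hmp]
  have hpre : Neg.neg ⁻¹' Ioo a b = Ioo (-b) (-a) := by simp
  rw [hpre]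
  refine setLIntegral_congr_fun_ae measurableSet_Ioo ?_
  have hae := (Measure.measurePreserving_neg (volume : Measure ℝ)).quasiMeasurePreserving.ae
    h.ae_mdifferentiableAt
  filter_upwards [hae] with t ht htm
  rw [S.speed_reverse U (ht ⟨by linarith [htm.2], by linarith [htm.1]⟩)]

open Classical in
theorem pathIntegral_concat_le (U : OneForm I M) (γ₁ γ₂ : ℝ → M) (a b c : ℝ) :
    S.pathIntegral U (fun t ↦ if t ≤ b then γ₁ t else γ₂ t) a c ≤
      S.pathIntegral U γ₁ a b + S.pathIntegral U γ₂ b c := by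
  have hsub : Ioo a c ⊆ (Ioo a b ∪ Ioo b c) ∪ {b} := by
    intro t ht
    rcases lt_trichotomy t b with h | h | h
    · exact Or.inl (Or.inl ⟨ht.1, h⟩)
    · exact Or.inr h
    · exact Or.inl (Or.inr ⟨h, ht.2⟩)
  rw [pathIntegral_eq]
  refine (lintegral_mono_set hsub).trans ((lintegral_union_le _ _ _).trans ?_)
  rw [Measure.restrict_singleton, Real.volume_singleton, zero_smul, lintegral_zero_measure, add_zero]
  refine (lintegral_union_le _ _ _).trans (add_le_add (le_of_eq ?_) (le_of_eq ?_))
  · refine setLIntegral_congr_fun measurableSet_Ioo fun t ht ↦ ?_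
    rw [S.speed_congr U (γ' := γ₁)]
    · rfl
    filter_upwards [Iio_mem_nhds ht.2] with u hu
    exact if_pos hu.le
  · refine setLIntegral_congr_fun measurableSet_Ioo fun t ht ↦ ?_
    rw [S.speed_congr U (γ' := γ₂)]
    · rfl
    filter_upwards [Ioi_mem_nhds ht.1] with u hu
    exact if_neg hu.not_ge

theorem infDist_le_pathIntegral (U : OneForm I M) {Z : Set M} {γ : ℝ → M} {a b : ℝ}
    (h : IsCurve I γ a b) (ha : γ a ∈ Z) : S.infDist U Z (γ b) ≤ S.pathIntegral U γ a b :=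
  sInf_le ⟨γ, a, b, h, ha, rfl, rfl⟩

theorem infDist_le_add (U : OneForm I M) (Z : Set M) {γ : ℝ → M} {a b : ℝ} (h : IsCurve I γ a b)
    (ha : γ a ∈ I.interior M) :
    S.infDist U Z (γ b) ≤ S.infDist U Z (γ a) + S.pathIntegral U γ a b := by
  conv_rhs => rw [infDist, ENNReal.sInf_add]
  refine le_iInf₂ ?_
  rintro _ ⟨γ₁, c, d, h₁, hc, hd, rfl⟩
  -- The second curve is re-timed to start at d, where the first one stops.
  have h₂ : IsCurve I (fun t ↦ γ (t + (a - d))) d (b - (a - d)) := by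
    simpa using h.shift (a - d)
  have hp := S.pathIntegral_shift U h (a - d)
  rw [sub_sub_cancel] at hp
  have h₃ := h₁.concat h₂ (by simp [hd]) (hd ▸ ha)
  have hle := S.infDist_le_pathIntegral U (Z := Z) h₃ (by simpa [h₁.lt.le] using hc)
  have hnot : ¬ b - (a - d) ≤ d := by linarith [h.lt]
  simp only [hnot, if_false, sub_add_cancel] at hle
  refine hle.trans ((S.pathIntegral_concat_le U _ _ _ _ _).trans ?_)
  rw [hp]

theorem infDist_le_add_reverse (U : OneForm I M) (Z : Set M) {γ : ℝ → M} {a b : ℝ}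
    (h : IsCurve I γ a b) (hb : γ b ∈ I.interior M) :
    S.infDist U Z (γ a) ≤ S.infDist U Z (γ b) + S.pathIntegral U γ a b := by
  have := S.infDist_le_add U Z h.reverse (by simpa using hb)
  simpa [S.pathIntegral_reverse U h] using this

end Spacetime

end Curves

/-! ### Chart segments and local bounds for the infimal path integrals -/

section Segments

variable {D : ℕ} {H : Type*} [TopologicalSpace H]
  {I : ModelWithCorners ℝ (EuclideanSpace ℝ (Fin D)) H}
  {M : Type*} [TopologicalSpace M] [ChartedSpace H M]

variable (I) in
/-- A segment in the chart at `x₀`. -/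
def chartSegment (x₀ : M) (z v : EuclideanSpace ℝ (Fin D)) (t : ℝ) : M :=
  (extChartAt I x₀).symm (z + t • v)

theorem chartSegment_zero (x₀ : M) (z v : EuclideanSpace ℝ (Fin D)) :
    chartSegment I x₀ z v 0 = (extChartAt I x₀).symm z := by
  simp [chartSegment]

variable [IsManifold I ∞ M]

theorem symm_mem_interior {x₀ : M} {z : EuclideanSpace ℝ (Fin D)}
    (hz : z ∈ (extChartAt I x₀).target) (hi : z ∈ interior (range I)) :
    (extChartAt I x₀).symm z ∈ I.interior M := by
  have hs : (extChartAt I x₀).symm z ∈ (chartAt H x₀).source := by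
    rw [← extChartAt_source I]; exact (extChartAt I x₀).map_target hz
  rw [mem_interior_iff_range hs, (extChartAt I x₀).right_inv hz]
  exact hi

theorem target_mem_nhds {x₀ : M} {z : EuclideanSpace ℝ (Fin D)}
    (hz : z ∈ (extChartAt I x₀).target) (hi : z ∈ interior (range I)) :
    (extChartAt I x₀).target ∈ 𝓝 z := by
  have hs : (extChartAt I x₀).symm z ∈ (chartAt H x₀).source := by
    rw [← extChartAt_source I]; exact (extChartAt I x₀).map_target hz
  have := (mem_interior_iff hs).1 (symm_mem_interior hz hi)
  rw [(extChartAt I x₀).right_inv hz] at this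
  exact mem_interior_iff_mem_nhds.1 this

theorem contMDiffAt_chartSegment {x₀ : M} {z v : EuclideanSpace ℝ (Fin D)} {t : ℝ}
    (ht : z + t • v ∈ (extChartAt I x₀).target) (hi : z + t • v ∈ interior (range I)) :
    ContMDiffAt 𝓘(ℝ, ℝ) I 1 (chartSegment I x₀ z v) t := by
  have h1 : ContMDiffAt 𝓘(ℝ, EuclideanSpace ℝ (Fin D)) I 1 (extChartAt I x₀).symm (z + t • v) :=
    (contMDiffOn_extChartAt_symm x₀).contMDiffAt (target_mem_nhds ht hi)
  exact ContMDiffAt.comp (I' := 𝓘(ℝ, EuclideanSpace ℝ (Fin D))) (g := (extChartAt I x₀).symm)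
    (f := fun t : ℝ ↦ z + t • v) t h1
    (by fun_prop : ContDiffAt ℝ 1 (fun t : ℝ ↦ z + t • v) t).contMDiffAt

theorem isCurve_chartSegment {x₀ : M} {z v : EuclideanSpace ℝ (Fin D)} {h : ℝ} (hh : 0 < h)
    (ht : ∀ t ∈ Icc 0 h, z + t • v ∈ (extChartAt I x₀).target)
    (hi : ∀ t ∈ Ioo 0 h, z + t • v ∈ interior (range I)) :
    IsCurve I (chartSegment I x₀ z v) 0 h where
  lt := hh
  continuousOn := (continuousOn_extChartAt_symm x₀).comp (by fun_prop) ht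
  mapsTo := fun t htt ↦ symm_mem_interior (ht t (Ioo_subset_Icc_self htt)) (hi t htt)
  piecewise := ⟨∅, fun t htt _ ↦
    contMDiffAt_chartSegment (ht t (Ioo_subset_Icc_self htt)) (hi t htt)⟩

namespace Spacetime

variable (S : Spacetime I M)

theorem speed_eq_coordPairing (U : OneForm I M) {γ : ℝ → M} {t : ℝ} {x₀ : M}
    (ht : γ t ∈ (chartAt H x₀).source) (hi : γ t ∈ I.interior M)
    (hγ : MDifferentiableAt 𝓘(ℝ, ℝ) I γ t) :
    S.speed U γ t = S.coordPairing U x₀ (γ t) (deriv (extChartAt I x₀ ∘ γ) t) := by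
  rw [speed, velocity_eq_frame ht hγ, S.wedgedot_eq_coordPairing U ht hi]

theorem speed_chartSegment (U : OneForm I M) {x₀ : M} {z v : EuclideanSpace ℝ (Fin D)} {t : ℝ}
    (ht : z + t • v ∈ (extChartAt I x₀).target) (hi : z + t • v ∈ interior (range I)) :
    S.speed U (chartSegment I x₀ z v) t =
      S.coordPairing U x₀ ((extChartAt I x₀).symm (z + t • v)) v := by
  have hs : chartSegment I x₀ z v t ∈ (chartAt H x₀).source := by
    rw [← extChartAt_source I]; exact (extChartAt I x₀).map_target ht
  rw [S.speed_eq_coordPairing U hs (symm_mem_interior ht hi)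
    ((contMDiffAt_chartSegment ht hi).mdifferentiableAt (by simp))]
  have hline : HasDerivAt (fun t : ℝ ↦ z + t • v) v t := by
    simpa using ((hasDerivAt_id t).smul_const v).const_add z
  have heq : extChartAt I x₀ ∘ chartSegment I x₀ z v =ᶠ[𝓝 t] fun t ↦ z + t • v := by
    filter_upwards [hline.continuousAt.preimage_mem_nhds (target_mem_nhds ht hi)] with u hu
    exact (extChartAt I x₀).right_inv hu
  rw [heq.deriv_eq, hline.deriv]
  rfl

theorem pathIntegral_chartSegment_le (U : OneForm I M) {x₀ : M} {z v : EuclideanSpace ℝ (Fin D)}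
    {h c : ℝ} (hh : 0 < h) (ht : ∀ t ∈ Icc 0 h, z + t • v ∈ (extChartAt I x₀).target)
    (hi : ∀ t ∈ Ioo 0 h, z + t • v ∈ interior (range I))
    (hc : ∀ t ∈ Ioo 0 h, S.coordPairing U x₀ ((extChartAt I x₀).symm (z + t • v)) v ≤ c) :
    S.pathIntegral U (chartSegment I x₀ z v) 0 h ≤ ENNReal.ofReal (c * h) := by
  rw [pathIntegral_eq]
  refine (setLIntegral_mono (g := fun _ ↦ ENNReal.ofReal c) measurable_const fun t htt ↦ ?_).trans ?_
  · rw [S.speed_chartSegment U (ht t (Ioo_subset_Icc_self htt)) (hi t htt)]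
    exact ENNReal.ofReal_le_ofReal (hc t htt)
  · rw [setLIntegral_const, Real.volume_Ioo, sub_zero, ENNReal.ofReal_mul' hh.le]

theorem coordPairing_smul (U : OneForm I M) (x₀ x : M) (a : ℝ) (v : EuclideanSpace ℝ (Fin D)) :
    S.coordPairing U x₀ x (a • v) = |a| * S.coordPairing U x₀ x v := by
  simp only [coordPairing, pairing, map_smul, smul_apply, smul_eq_mul]
  rw [mul_max_of_nonneg _ _ (abs_nonneg a), abs_mul, ← Real.sqrt_sq (abs_nonneg a),
    ← Real.sqrt_mul (sq_nonneg _), Real.sqrt_sq (abs_nonneg a)]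
  congr 2
  rw [← abs_of_nonneg (sq_nonneg |a|), ← abs_mul, sq_abs]
  congr 1
  ring

/-- Locally the pairing is bounded by a multiple of the coordinate norm. -/
theorem exists_coordPairing_le {U : OneForm I M} (hU : IsContinuousOneForm I U) {x₀ x : M}
    (hx : x ∈ (chartAt H x₀).source) :
    ∃ C : ℝ, 0 ≤ C ∧ ∀ᶠ y in 𝓝 x, ∀ v, S.coordPairing U x₀ y v ≤ C * ‖v‖ := by
  -- The pairing vanishes at (x, 0), so it is below 1 on a product neighbourhood; homogeneity
  -- extends the bound to all v.
  have hcont := (S.continuousOn_coordPairing hU x₀).continuousAt (x := (x, 0))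
    (((chartAt H x₀).open_source.prod isOpen_univ).mem_nhds ⟨hx, mem_univ _⟩)
  have h0 : S.coordPairing U x₀ x 0 = 0 := by simp [coordPairing, pairing]
  have hev := hcont.eventually (gt_mem_nhds (show S.coordPairing U x₀ x 0 < 1 by simp [h0]))
  obtain ⟨s, hs, t, ht, hst⟩ := mem_nhds_prod_iff.1 hev
  obtain ⟨δ, hδ, hball⟩ := Metric.mem_nhds_iff.1 ht
  refine ⟨2 / δ, by positivity, Filter.mem_of_superset hs fun y hy v ↦ ?_⟩
  by_cases hv : v = 0
  · simp [hv, coordPairing, pairing]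
  have hv' : 0 < ‖v‖ := norm_pos_iff.2 hv
  set w := (δ / (2 * ‖v‖)) • v with hw
  have hwt : w ∈ t := hball (by
    rw [mem_ball_zero_iff, hw, norm_smul, Real.norm_of_nonneg (by positivity)]
    have : δ / (2 * ‖v‖) * ‖v‖ = δ / 2 := by field_simp
    rw [this]; linarith)
  have hlt : S.coordPairing U x₀ y w < 1 := hst (mk_mem_prod hy hwt)
  rw [hw, coordPairing_smul, abs_of_nonneg (by positivity)] at hlt
  have : δ * S.coordPairing U x₀ y v < 2 * ‖v‖ := by
    rw [div_mul_eq_mul_div, div_lt_one (by positivity)] at hlt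
    exact hlt
  rw [div_mul_eq_mul_div, le_div_iff₀ hδ]
  linarith

/-- Near any point, in any chart, points are joined by segments whose path integral is controlled
by the coordinate distance, as soon as one of the ends is an interior point. -/
theorem exists_chartSegment_bound {U : OneForm I M} (hU : IsContinuousOneForm I U) {x₀ x : M}
    (hx : x ∈ (chartAt H x₀).source) :
    ∃ r > 0, ∃ C : NNReal, Metric.ball (extChartAt I x₀ x) r ∩ range I ⊆ (extChartAt I x₀).target ∧
      ∀ z ∈ Metric.ball (extChartAt I x₀ x) r ∩ range I,
      ∀ w ∈ Metric.ball (extChartAt I x₀ x) r ∩ range I,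
      z ∈ interior (range I) ∨ w ∈ interior (range I) →
      IsCurve I (chartSegment I x₀ z (w - z)) 0 1 ∧
        S.pathIntegral U (chartSegment I x₀ z (w - z)) 0 1 ≤ C * edist w z := by
  obtain ⟨C, hC, hev⟩ := S.exists_coordPairing_le hU hx
  have hxs : x ∈ (extChartAt I x₀).source := by rwa [extChartAt_source]
  have hxt : extChartAt I x₀ x ∈ (extChartAt I x₀).target := (extChartAt I x₀).map_source hxs
  have h1 : (extChartAt I x₀).target ∈ 𝓝[range I] (extChartAt I x₀ x) :=
    extChartAt_target_mem_nhdsWithin' hxs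
  have h2 : ∀ᶠ z in 𝓝[range I] (extChartAt I x₀ x), ∀ v,
      S.coordPairing U x₀ ((extChartAt I x₀).symm z) v ≤ C * ‖v‖ := by
    have hcont := continuousAt_extChartAt_symm'' hxt
    rw [ContinuousAt, (extChartAt I x₀).left_inv hxs] at hcont
    exact (hcont.eventually hev).filter_mono nhdsWithin_le_nhds
  obtain ⟨r, hr, hball⟩ := Metric.mem_nhdsWithin_iff.1 (Filter.inter_mem h1 h2)
  refine ⟨r, hr, C.toNNReal, fun z hz ↦ (hball hz).1, fun z hz w hw hzw ↦ ?_⟩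
  have hconv : Convex ℝ (Metric.ball (extChartAt I x₀ x) r ∩ range I) :=
    (convex_ball _ _).inter I.convex_range
  have hmem : ∀ t ∈ Icc (0 : ℝ) 1,
      z + t • (w - z) ∈ Metric.ball (extChartAt I x₀ x) r ∩ range I :=
    fun t ht ↦ hconv.add_smul_sub_mem hz hw ht
  -- In the convex set `range I`, a segment with one interior end has all its relative interior
  -- points in the interior.
  have hint : ∀ t ∈ Ioo (0 : ℝ) 1, z + t • (w - z) ∈ interior (range I) := by
    intro t ht
    have heq : z + t • (w - z) = (1 - t) • z + t • w := by module
    rw [heq]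
    rcases hzw with h | h
    · exact I.convex_range.combo_interior_self_mem_interior h hw.2 (by linarith [ht.2]) ht.1.le
        (by ring)
    · exact I.convex_range.combo_self_interior_mem_interior hz.2 h (by linarith [ht.2]) ht.1
        (by ring)
  refine ⟨isCurve_chartSegment one_pos (fun t ht ↦ (hball (hmem t ht)).1) hint, ?_⟩
  refine (S.pathIntegral_chartSegment_le U one_pos (fun t ht ↦ (hball (hmem t ht)).1) hint
    fun t ht ↦ (hball (hmem t (Ioo_subset_Icc_self ht))).2 _).trans_eq ?_
  rw [mul_one, ENNReal.ofReal_mul hC, edist_eq_enorm_sub, ofReal_norm]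
  rfl

/-- The infimal path integral is Lipschitz in coordinates, up to the boundary. -/
theorem exists_infDist_le {U : OneForm I M} (hU : IsContinuousOneForm I U) {x₀ x : M}
    (hx : x ∈ (chartAt H x₀).source) :
    ∃ r > 0, ∃ C : NNReal, Metric.ball (extChartAt I x₀ x) r ∩ range I ⊆ (extChartAt I x₀).target ∧
      ∀ (Z : Set M), ∀ z ∈ Metric.ball (extChartAt I x₀ x) r ∩ range I,
      ∀ w ∈ Metric.ball (extChartAt I x₀ x) r ∩ range I,
      S.infDist U Z ((extChartAt I x₀).symm w) ≤
        S.infDist U Z ((extChartAt I x₀).symm z) + C * edist w z := by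
  obtain ⟨r, hr, C, htar, hseg⟩ := S.exists_chartSegment_bound hU hx
  refine ⟨r, hr, C, htar, fun Z z hz w hw ↦ ?_⟩
  conv_rhs => rw [infDist, ENNReal.sInf_add]
  refine le_iInf₂ ?_
  rintro _ ⟨γ, a, b, hγ, ha, hb, rfl⟩
  set φ := extChartAt I x₀
  have hbs : γ b ∈ φ.source := hb ▸ φ.map_target (htar hz)
  have hφb : φ (γ b) = z := by rw [hb]; exact φ.right_inv (htar hz)
  have hγb : Filter.Tendsto γ (𝓝[<] b) (𝓝 (γ b)) := by
    have := (hγ.continuousOn b (right_mem_Icc.2 hγ.lt.le)).mono Ioo_subset_Icc_self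
    rwa [ContinuousWithinAt, nhdsWithin_Ioo_eq_nhdsLT hγ.lt] at this
  have hφγ : Filter.Tendsto (fun t ↦ φ (γ t)) (𝓝[<] b) (𝓝 z) := by
    have := (continuousAt_extChartAt' (I := I) hbs).tendsto.comp hγb
    rwa [hφb] at this
  -- If z is a boundary point, γ cannot be prolonged through it. It is left at the interior point γ
  -- t instead, a segment is followed to w, and t tends to b.
  have hlim : Filter.Tendsto (fun t ↦ S.pathIntegral U γ a b + C * edist w (φ (γ t))) (𝓝[<] b)
      (𝓝 (S.pathIntegral U γ a b + C * edist w z)) := by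
    refine tendsto_const_nhds.add (ENNReal.Tendsto.const_mul ?_ (Or.inr ENNReal.coe_ne_top))
    exact tendsto_const_nhds.edist hφγ
  refine ge_of_tendsto hlim ?_
  filter_upwards [hγb ((isOpen_extChartAt_source x₀).mem_nhds hbs),
    hφγ (Metric.isOpen_ball.mem_nhds hz.1), Ioo_mem_nhdsLT hγ.lt] with t hts htb htab
  have hti : γ t ∈ I.interior M := hγ.mapsTo htab
  have hti' : φ (γ t) ∈ interior (range I) :=
    (mem_interior_iff_range (by rwa [← extChartAt_source I])).1 hti
  obtain ⟨hc, hp⟩ := hseg (φ (γ t)) ⟨htb, interior_subset hti'⟩ w hw (Or.inl hti')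
  have h0 : chartSegment I x₀ (φ (γ t)) (w - φ (γ t)) 0 = γ t := by
    rw [chartSegment_zero]; exact φ.left_inv hts
  have h1 : chartSegment I x₀ (φ (γ t)) (w - φ (γ t)) 1 = φ.symm w := by
    simp [chartSegment, φ]
  have h2 := S.infDist_le_add U Z hc (by rwa [h0])
  rw [h0, h1] at h2
  refine h2.trans (add_le_add ?_ hp)
  exact (S.infDist_le_pathIntegral U (hγ.restrict htab.1 htab.2.le) ha).trans
    (S.pathIntegral_restrict_le U γ htab.2.le)

/-- A constant curve is not admissible at a boundary point. A short segment into the interior,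
combined with the Lipschitz bound back to x, costs arbitrarily little. -/
theorem infDist_eq_zero {U : OneForm I M} (hU : IsContinuousOneForm I U) {Z : Set M} {x : M}
    (hx : x ∈ Z) : S.infDist U Z x = 0 := by
  obtain ⟨r₁, hr₁, C₁, -, hseg⟩ := S.exists_chartSegment_bound hU (mem_chart_source H x)
  obtain ⟨r₂, hr₂, C₂, -, hlip⟩ := S.exists_infDist_le hU (mem_chart_source H x)
  set φ := extChartAt I x
  have hφx : φ.symm (φ x) = x := φ.left_inv (mem_extChartAt_source x)
  have hxr : φ x ∈ range I := extChartAt_target_subset_range x (mem_extChartAt_target x)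
  have hcl : φ x ∈ closure (interior (range I)) := by
    rw [I.convex_range.closure_interior_eq_closure_of_nonempty_interior I.nonempty_interior]
    exact subset_closure hxr
  have hlim : Filter.Tendsto (fun z ↦ C₁ * edist z (φ x) + C₂ * edist (φ x) z)
      (𝓝[interior (range I)] (φ x)) (𝓝 (C₁ * edist (φ x) (φ x) + C₂ * edist (φ x) (φ x))) := by
    refine Filter.Tendsto.mono_left ?_ nhdsWithin_le_nhds
    refine (ENNReal.Tendsto.const_mul ?_ (Or.inr ENNReal.coe_ne_top)).add
      (ENNReal.Tendsto.const_mul ?_ (Or.inr ENNReal.coe_ne_top))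
    · exact Filter.tendsto_id.edist tendsto_const_nhds
    · exact tendsto_const_nhds.edist Filter.tendsto_id
  have := mem_closure_iff_nhdsWithin_neBot.1 hcl
  rw [edist_self, mul_zero, mul_zero, add_zero] at hlim
  refine le_antisymm (ge_of_tendsto hlim ?_) bot_le
  filter_upwards [self_mem_nhdsWithin,
    nhdsWithin_le_nhds (Metric.ball_mem_nhds (φ x) hr₁),
    nhdsWithin_le_nhds (Metric.ball_mem_nhds (φ x) hr₂)] with z hzi hz₁ hz₂
  have hzr := interior_subset hzi
  obtain ⟨hc, hp⟩ := hseg (φ x) ⟨Metric.mem_ball_self hr₁, hxr⟩ z ⟨hz₁, hzr⟩ (Or.inr hzi)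
  have h1 := S.infDist_le_pathIntegral U hc (Z := Z) (by
    rw [chartSegment_zero]; exact hφx.symm ▸ hx)
  have h2 := hlip Z z ⟨hz₂, hzr⟩ (φ x) ⟨Metric.mem_ball_self hr₂, hxr⟩
  have h3 : chartSegment I x (φ x) (z - φ x) 1 = φ.symm z := by simp [chartSegment, φ]
  rw [hφx] at h2
  rw [h3] at h1
  exact h2.trans (by gcongr; exact h1.trans hp)

/-- At an interior y, a curve from A followed by a reversed curve from B would join A to B. At a
boundary y the curve from B is cut at γ t, and the Lipschitz bound for d_A absorbs the gap as t
tends to b. -/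
theorem one_le_infDist_add {U : OneForm I M} (hU : IsContinuousOneForm I U) {DA DB : Set M}
    (hN : S.NormBound U DA DB) (y : M) : 1 ≤ S.infDist U DA y + S.infDist U DB y := by
  obtain ⟨r, hr, C, -, hlip⟩ := S.exists_infDist_le hU (mem_chart_source H y)
  conv_rhs => rw [add_comm, infDist, ENNReal.sInf_add]
  refine le_iInf₂ ?_
  rintro _ ⟨γ, a, b, hγ, ha, rfl, rfl⟩
  set φ := extChartAt I (γ b)
  have hbs : γ b ∈ φ.source := mem_extChartAt_source (γ b)
  have hγb : Filter.Tendsto γ (𝓝[<] b) (𝓝 (γ b)) := by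
    have := (hγ.continuousOn b (right_mem_Icc.2 hγ.lt.le)).mono Ioo_subset_Icc_self
    rwa [ContinuousWithinAt, nhdsWithin_Ioo_eq_nhdsLT hγ.lt] at this
  have hφγ : Filter.Tendsto (fun t ↦ φ (γ t)) (𝓝[<] b) (𝓝 (φ (γ b))) :=
    (continuousAt_extChartAt' (I := I) hbs).tendsto.comp hγb
  have hlim : Filter.Tendsto (fun t ↦ S.infDist U DA (γ b) + C * edist (φ (γ t)) (φ (γ b)) +
      S.pathIntegral U γ a b) (𝓝[<] b)
      (𝓝 (S.infDist U DA (γ b) + C * edist (φ (γ b)) (φ (γ b)) + S.pathIntegral U γ a b)) := by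
    refine (tendsto_const_nhds.add (ENNReal.Tendsto.const_mul ?_
      (Or.inr ENNReal.coe_ne_top))).add tendsto_const_nhds
    exact hφγ.edist tendsto_const_nhds
  rw [edist_self, mul_zero, add_zero] at hlim
  rw [add_comm]
  refine ge_of_tendsto hlim ?_
  filter_upwards [hγb ((isOpen_extChartAt_source (I := I) (γ b)).mem_nhds hbs),
    hφγ (Metric.ball_mem_nhds _ hr), Ioo_mem_nhdsLT hγ.lt] with t hts htb htab
  have hone : 1 ≤ S.infDist U DA (γ a) := by
    refine le_sInf ?_
    rintro _ ⟨γ', a', b', h', ha', hb', rfl⟩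
    exact hN.2 γ' a' b' h' ha' (hb' ▸ ha)
  have h1 := S.infDist_le_add_reverse U DA (hγ.restrict htab.1 htab.2.le) (hγ.mapsTo htab)
  have h2 := hlip DA (φ (γ b)) ⟨Metric.mem_ball_self hr,
    extChartAt_target_subset_range _ (φ.map_source hbs)⟩ (φ (γ t))
    ⟨htb, extChartAt_target_subset_range _ (φ.map_source hts)⟩
  rw [φ.left_inv hbs, φ.left_inv hts] at h2
  exact hone.trans (h1.trans (add_le_add h2 (S.pathIntegral_restrict_le U γ htab.2.le)))

/-- Infinitesimal form of the Lipschitz bound at interior points. -/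
theorem eventually_infDist_le {U : OneForm I M} (hU : IsContinuousOneForm I U) {x₀ : M}
    {z : EuclideanSpace ℝ (Fin D)} (hz : z ∈ (extChartAt I x₀).target)
    (hi : z ∈ interior (range I)) (v : EuclideanSpace ℝ (Fin D)) {r : ℝ}
    (hr : S.coordPairing U x₀ ((extChartAt I x₀).symm z) v < r) :
    ∀ᶠ h in 𝓝[>] (0 : ℝ), ∀ Z : Set M,
      S.infDist U Z ((extChartAt I x₀).symm (z + h • v)) ≤
        S.infDist U Z ((extChartAt I x₀).symm z) + ENNReal.ofReal (r * h) ∧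
      S.infDist U Z ((extChartAt I x₀).symm z) ≤
        S.infDist U Z ((extChartAt I x₀).symm (z + h • v)) + ENNReal.ofReal (r * h) := by
  set φ := extChartAt I x₀
  have hline : Filter.Tendsto (fun t : ℝ ↦ z + t • v) (𝓝 0) (𝓝 z) := by
    have : Continuous fun t : ℝ ↦ z + t • v := by fun_prop
    simpa using this.tendsto 0
  have hs : φ.symm z ∈ (chartAt H x₀).source := by
    rw [← extChartAt_source I]; exact φ.map_target hz
  have hF : ContinuousAt (fun t : ℝ ↦ S.coordPairing U x₀ (φ.symm (z + t • v)) v) 0 := by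
    have h1 := (S.continuousOn_coordPairing hU x₀).continuousAt (x := (φ.symm z, v))
      (((chartAt H x₀).open_source.prod isOpen_univ).mem_nhds ⟨hs, mem_univ _⟩)
    have h2 : Filter.Tendsto (fun t : ℝ ↦ (φ.symm (z + t • v), v)) (𝓝 0) (𝓝 (φ.symm z, v)) :=
      ((continuousAt_extChartAt_symm'' hz).tendsto.comp hline).prodMk_nhds tendsto_const_nhds
    have h3 := h1.tendsto.comp h2
    simpa [ContinuousAt, Function.comp_def] using h3
  -- The strict bound at z persists along a short segment. Its length does not depend on Z, so d_A
  -- and d_B can be treated with the same h.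
  have hev : ∀ᶠ t in 𝓝 (0 : ℝ), z + t • v ∈ φ.target ∧ z + t • v ∈ interior (range I) ∧
      S.coordPairing U x₀ (φ.symm (z + t • v)) v < r :=
    (hline.eventually_mem (target_mem_nhds hz hi)).and
      ((hline.eventually_mem (isOpen_interior.mem_nhds hi)).and
      (hF.eventually (gt_mem_nhds (by simpa using hr))))
  obtain ⟨δ, hδ, hball⟩ := Metric.eventually_nhds_iff.1 hev
  filter_upwards [Ioo_mem_nhdsGT hδ] with h hh Z
  have hmem : ∀ t ∈ Icc 0 h, z + t • v ∈ φ.target ∧ z + t • v ∈ interior (range I) ∧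
      S.coordPairing U x₀ (φ.symm (z + t • v)) v < r := fun t ht ↦ hball (by
    rw [Real.dist_eq, sub_zero, abs_of_nonneg ht.1]; exact ht.2.trans_lt hh.2)
  have hcurve := isCurve_chartSegment (M := M) (I := I) hh.1 (fun t ht ↦ (hmem t ht).1)
    (fun t ht ↦ (hmem t (Ioo_subset_Icc_self ht)).2.1)
  have hlen := S.pathIntegral_chartSegment_le U hh.1 (fun t ht ↦ (hmem t ht).1)
    (fun t ht ↦ (hmem t (Ioo_subset_Icc_self ht)).2.1)
    (fun t ht ↦ (hmem t (Ioo_subset_Icc_self ht)).2.2.le)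
  have h0 : chartSegment I x₀ z v 0 = φ.symm z := chartSegment_zero _ _ _
  have h1 : chartSegment I x₀ z v h = φ.symm (z + h • v) := rfl
  have he := hmem h (right_mem_Icc.2 hh.1.le)
  have k1 := S.infDist_le_add U Z hcurve (by rw [h0]; exact symm_mem_interior hz hi)
  have k2 := S.infDist_le_add_reverse U Z hcurve (symm_mem_interior he.1 he.2.1)
  rw [h0, h1] at k1 k2
  exact ⟨k1.trans (by gcongr), k2.trans (by gcongr)⟩

end Spacetime

end Segments

/-! ### From the path bound to the explicit witness -/

section Witness

/-- Here p, q are the distances from A and B at one point, and p', q' those at another. The bound 1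
≤ p + q matters in one case only: the first point lies in the B-piece and the second in the A-piece.
-/
theorem toReal_ite_sub_le {p q p' q' δ : ℝ≥0∞} (hδ : δ ≠ ⊤) (hp : p ≤ p' + δ) (hq' : q' ≤ q + δ)
    (h : 1 ≤ p + q) :
    (if p < 1 / 2 then p.toReal - 1 / 2 else if q < 1 / 2 then 1 / 2 - q.toReal else 0) ≤
      (if p' < 1 / 2 then p'.toReal - 1 / 2 else if q' < 1 / 2 then 1 / 2 - q'.toReal else 0) +
        δ.toReal := by
  have half : ((1 / 2 : ℝ≥0∞)).toReal = 1 / 2 := by simp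
  have htop : (1 / 2 : ℝ≥0∞) ≠ ⊤ := by simp
  have lt : ∀ {x : ℝ≥0∞}, x < 1 / 2 → x ≠ ⊤ ∧ x.toReal < 1 / 2 := fun {x} hx ↦
    ⟨(hx.trans_le le_top).ne, by rw [← half]; exact (ENNReal.toReal_lt_toReal
      (hx.trans_le le_top).ne htop).2 hx⟩
  have hd := ENNReal.toReal_nonneg (a := δ)
  have le : ∀ {x y : ℝ≥0∞}, y ≠ ⊤ → x ≤ y + δ → x.toReal ≤ y.toReal + δ.toReal :=
    fun {x y} hy hxy ↦ by
      rw [← ENNReal.toReal_add hy hδ]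
      exact ENNReal.toReal_mono (ENNReal.add_ne_top.2 ⟨hy, hδ⟩) hxy
  have hle : ∀ {x y : ℝ≥0∞}, y ≠ ⊤ → ¬ x < 1 / 2 → x ≤ y + δ → 1 / 2 ≤ y.toReal + δ.toReal :=
    fun {x y} hy hx hxy ↦ by
      rw [← half, ← ENNReal.toReal_add hy hδ]
      exact ENNReal.toReal_mono (ENNReal.add_ne_top.2 ⟨hy, hδ⟩) ((not_lt.1 hx).trans hxy)
  split_ifs with h1 h2 h3 h4 h5 h6 h7 h8
  · linarith [le (lt h2).1 hp]
  · linarith [(lt h1).2, (lt h3).2]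
  · linarith [(lt h1).2]
  · have hsum : 1 ≤ p'.toReal + δ.toReal + q.toReal := by
      have := ENNReal.toReal_mono (b := p' + δ + q)
        (ENNReal.add_ne_top.2 ⟨ENNReal.add_ne_top.2 ⟨(lt h5).1, hδ⟩, (lt h4).1⟩)
        (h.trans (by gcongr))
      rwa [ENNReal.toReal_add (ENNReal.add_ne_top.2 ⟨(lt h5).1, hδ⟩) (lt h4).1,
        ENNReal.toReal_add (lt h5).1 hδ, ENNReal.toReal_one] at this
    linarith
  · linarith [le (lt h4).1 hq']
  · linarith [hle (lt h4).1 h6 hq']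
  · linarith [hle (lt h7).1 h1 hp]
  · linarith [(lt h8).2]
  · linarith

variable {D : ℕ} {H : Type*} [TopologicalSpace H]
  {I : ModelWithCorners ℝ (EuclideanSpace ℝ (Fin D)) H}
  {M : Type*} [TopologicalSpace M] [ChartedSpace H M]

theorem IsLocallyLipschitz.continuous {ψ : M → ℝ} (hψ : IsLocallyLipschitz I ψ) :
    Continuous ψ := by
  refine continuous_iff_continuousAt.2 fun x ↦ ?_
  obtain ⟨K, s, hs, hK⟩ := hψ x
  have hx : extChartAt I x x ∈ s :=
    mem_of_mem_nhdsWithin (extChartAt_target_subset_range x (mem_extChartAt_target x)) hs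
  have h1 : ContinuousWithinAt (ψ ∘ (extChartAt I x).symm) (range I) (extChartAt I x x) :=
    (hK.continuousOn _ hx).mono_of_mem_nhdsWithin hs
  have h2 : Filter.Tendsto (extChartAt I x) (𝓝 x) (𝓝[range I] (extChartAt I x x)) := by
    refine tendsto_nhdsWithin_iff.2 ⟨(continuousAt_extChartAt x).tendsto, ?_⟩
    filter_upwards [extChartAt_source_mem_nhds (I := I) x] with y hy
    exact extChartAt_target_subset_range x ((extChartAt I x).map_source hy)
  have h3 := h1.tendsto.comp h2
  simp only [Function.comp_apply, extChartAt_to_inv] at h3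
  refine h3.congr' ?_
  filter_upwards [extChartAt_source_mem_nhds (I := I) x] with y hy
  simp only [Function.comp_apply, (extChartAt I x).left_inv hy]

variable [IsManifold I ∞ M]

namespace Spacetime

variable (S : Spacetime I M)

theorem distWitness_sub_le {U : OneForm I M} (hU : IsContinuousOneForm I U) {DA DB : Set M}
    (hN : S.NormBound U DA DB) {x y : M} {δ : ℝ≥0∞} (hδ : δ ≠ ⊤)
    (hA : S.infDist U DA x ≤ S.infDist U DA y + δ)
    (hB : S.infDist U DB y ≤ S.infDist U DB x + δ) :
    S.distWitness U DA DB x ≤ S.distWitness U DA DB y + δ.toReal :=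
  toReal_ite_sub_le hδ hA hB (S.one_le_infDist_add hU hN x)

theorem exists_lipschitzOnWith_distWitness {U : OneForm I M} (hU : IsContinuousOneForm I U)
    {DA DB : Set M} (hN : S.NormBound U DA DB) {x₀ x : M} (hx : x ∈ (chartAt H x₀).source) :
    ∃ r > 0, ∃ C, LipschitzOnWith C (S.distWitness U DA DB ∘ (extChartAt I x₀).symm)
      (Metric.ball (extChartAt I x₀ x) r ∩ range I) := by
  obtain ⟨r, hr, C, -, hlip⟩ := S.exists_infDist_le hU hx
  refine ⟨r, hr, C, LipschitzOnWith.of_le_add_mul C fun z hz w hw ↦ ?_⟩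
  have := S.distWitness_sub_le hU hN (δ := C * edist z w)
    (ENNReal.mul_ne_top ENNReal.coe_ne_top (edist_ne_top _ _)) (hlip DA w hw z hz)
    (by rw [edist_comm]; exact hlip DB z hz w hw)
  rwa [ENNReal.toReal_mul, ENNReal.coe_toReal, ← dist_edist] at this

/-- For every r above the pairing, the right difference quotients in direction v are eventually at
most r. -/
theorem fderiv_distWitness_le {U : OneForm I M} (hU : IsContinuousOneForm I U) {DA DB : Set M}
    (hN : S.NormBound U DA DB) {x₀ : M} {z : EuclideanSpace ℝ (Fin D)}
    (hz : z ∈ (extChartAt I x₀).target) (hi : z ∈ interior (range I))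
    (hd : DifferentiableAt ℝ (S.distWitness U DA DB ∘ (extChartAt I x₀).symm) z)
    (v : EuclideanSpace ℝ (Fin D)) :
    fderiv ℝ (S.distWitness U DA DB ∘ (extChartAt I x₀).symm) z v ≤
      S.coordPairing U x₀ ((extChartAt I x₀).symm z) v := by
  set f := S.distWitness U DA DB ∘ (extChartAt I x₀).symm
  refine le_of_forall_gt_imp_ge_of_dense fun r hr ↦ ?_
  have hr0 : 0 ≤ r := (S.coordPairing_nonneg U x₀ _ v).trans hr.le
  have hline : HasDerivAt (fun t : ℝ ↦ z + t • v) v 0 := by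
    simpa using ((hasDerivAt_id (0 : ℝ)).smul_const v).const_add z
  have hder : HasDerivAt (fun t : ℝ ↦ f (z + t • v)) (fderiv ℝ f z v) 0 := by
    have h := hd.hasFDerivAt
    rw [show z = z + (0 : ℝ) • v by simp] at h
    have h' := h.comp_hasDerivAt (0 : ℝ) hline
    rw [zero_smul, add_zero] at h'
    exact h'
  have hslope := (hasDerivAt_iff_tendsto_slope.1 hder).mono_left
    (nhdsWithin_mono 0 fun t (ht : t ∈ Ioi (0 : ℝ)) ↦ ht.ne')
  refine le_of_tendsto hslope ?_
  filter_upwards [S.eventually_infDist_le hU hz hi v hr, self_mem_nhdsWithin] with h hh hpos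
  have hpos : 0 < h := hpos
  have := S.distWitness_sub_le hU hN ENNReal.ofReal_ne_top (hh DA).1 (hh DB).2
  rw [ENNReal.toReal_ofReal (mul_nonneg hr0 hpos.le)] at this
  rw [slope_def_field, sub_zero, div_le_iff₀ hpos]
  simp only [f, Function.comp_apply, zero_smul, add_zero]
  linarith

/-- On future causal vectors the pairing is at most U(v). Applying the hypothesis to v and −v, with
evenness of the pairing, bounds both X and −X. -/
theorem mem_fdc_of_diff_le {U : OneForm I M} {x₀ x : M} (hx : x ∈ (chartAt H x₀).source)
    (hi : x ∈ I.interior M) (hUx : U x ∈ S.fdc x) {X : TangentSpace I x →L[ℝ] ℝ}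
    (hX : ∀ v, X (frame I x₀ x v) ≤ S.coordPairing U x₀ x v) :
    U x + X ∈ S.fdc x ∧ U x - X ∈ S.fdc x := by
  have key : ∀ v, S.FutureCausalVec x v → X v ≤ U x v ∧ -X v ≤ U x v := by
    intro v hv
    have hle : pairing (S.g x) (U x) v ≤ U x v :=
      (S.lorentzian.isLorentzForm hi).pairing_le_of_causal (S.T_timelike x hi)
        (fun k h1 h2 h3 ↦ hUx k ⟨h1, h2, h3⟩) hv.1 hv.2.1 hv.2.2
    obtain ⟨w, rfl⟩ := (frameEquiv I hx).surjective v
    rw [frameEquiv_apply] at hle ⊢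
    rw [← S.wedgedot_eq_pairing hi, S.wedgedot_eq_coordPairing U hx hi] at hle
    refine ⟨(hX w).trans hle, ?_⟩
    have := hX (-w)
    rw [map_neg, map_neg, S.coordPairing_neg] at this
    exact this.trans hle
  constructor <;> intro v hv <;> obtain ⟨h1, h2⟩ := key v hv
  · change 0 ≤ U x v + X v
    linarith
  · change 0 ≤ U x v - X v
    linarith

theorem NormBound.isWitness {U : OneForm I M} (hU : IsContinuousOneForm I U) {DA DB : Set M}
    (hN : S.NormBound U DA DB) : S.IsWitness U DA DB (S.distWitness U DA DB) := by
  have hlip : IsLocallyLipschitz I (S.distWitness U DA DB) := fun x ↦ by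
    obtain ⟨r, hr, C, hC⟩ := S.exists_lipschitzOnWith_distWitness hU hN (mem_chart_source H x)
    exact ⟨C, _, Filter.inter_mem (nhdsWithin_le_nhds (Metric.ball_mem_nhds _ hr))
      self_mem_nhdsWithin, hC⟩
  have half : ((1 / 2 : ℝ≥0∞)).toReal = 1 / 2 := by simp
  have hlt : ∀ {p : ℝ≥0∞}, p < 1 / 2 → p.toReal < 1 / 2 := fun {p} hp ↦ by
    rw [← half]
    exact (ENNReal.toReal_lt_toReal (hp.trans_le le_top).ne (by simp)).2 hp
  refine ⟨fun x ↦ ?_, fun x hx ↦ ?_, fun x hx ↦ ?_, hlip, fun x₀ ↦ ?_⟩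
  · rw [distWitness]
    split_ifs with h1 h2
    · have := hlt h1
      have := ENNReal.toReal_nonneg (a := S.infDist U DA x)
      constructor <;> linarith
    · have := hlt h2
      have := ENNReal.toReal_nonneg (a := S.infDist U DB x)
      constructor <;> linarith
    · constructor <;> norm_num
  · rw [distWitness, S.infDist_eq_zero hU hx, if_pos (by simp)]
    norm_num
  · have h0 := S.infDist_eq_zero hU hx
    have h1 := S.one_le_infDist_add hU hN x
    rw [h0, add_zero] at h1
    have h2 : ¬ S.infDist U DA x < 1 / 2 := not_lt.2 (le_trans (by simp) h1)
    rw [distWitness, if_neg h2, h0, if_pos (by simp)]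
    norm_num
  -- Rademacher's theorem needs a Lipschitz bound, available only on small balls, so nullity is
  -- checked locally.
  · have hae : ∀ᵐ z : EuclideanSpace ℝ (Fin D), z ∈ (extChartAt I x₀).target →
        z ∈ interior (range I) →
        DifferentiableAt ℝ (S.distWitness U DA DB ∘ (extChartAt I x₀).symm) z := by
      rw [ae_iff]
      refine measure_null_of_locally_null _ fun z hz ↦ ?_
      simp only [mem_ofPred_eq, Classical.not_imp] at hz
      have hs : (extChartAt I x₀).symm z ∈ (chartAt H x₀).source := by
        rw [← extChartAt_source I]; exact (extChartAt I x₀).map_target hz.1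
      obtain ⟨r, hr, C, hC⟩ := S.exists_lipschitzOnWith_distWitness hU hN hs
      rw [(extChartAt I x₀).right_inv hz.1] at hC
      refine ⟨_, inter_mem_nhdsWithin _ (Metric.ball_mem_nhds z hr), ?_⟩
      refine measure_mono_null ?_
        (ae_iff.1 (hC.ae_differentiableWithinAt_of_mem (μ := volume)))
      rintro w ⟨hw, hwb⟩ hgood
      simp only [mem_ofPred_eq, Classical.not_imp] at hw
      refine hw.2.2 ((hgood ⟨hwb, interior_subset hw.2.1⟩).differentiableAt ?_)
      exact Filter.inter_mem (Metric.isOpen_ball.mem_nhds hwb)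
        (mem_interior_iff_mem_nhds.1 hw.2.1)
    filter_upwards [hae] with z hz hzt hi
    have hs : (extChartAt I x₀).symm z ∈ (chartAt H x₀).source := by
      rw [← extChartAt_source I]; exact (extChartAt I x₀).map_target hzt
    have hzi : z ∈ interior (range I) := by
      have := (mem_interior_iff_range hs).1 hi
      rwa [(extChartAt I x₀).right_inv hzt] at this
    have hd := hz hzt hzi
    have hmd : MDifferentiableAt I 𝓘(ℝ, ℝ) (S.distWitness U DA DB) ((extChartAt I x₀).symm z) := by
      rw [mdifferentiableAt_iff_coord hs hi hlip.continuous.continuousAt,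
        (extChartAt I x₀).right_inv hzt]
      exact hd
    refine ⟨hmd, S.mem_fdc_of_diff_le hs hi (hN.1 _ hi) fun v ↦ ?_⟩
    rw [diff_frame hs hi hmd, (extChartAt I x₀).right_inv hzt]
    exact S.fderiv_distWitness_le hU hN hzt hzi hd v

end Spacetime

end Witness

/-! ### From a witness to the path bound -/

section NormBound

variable {D : ℕ} {H : Type*} [TopologicalSpace H]
  {I : ModelWithCorners ℝ (EuclideanSpace ℝ (Fin D)) H}
  {M : Type*} [TopologicalSpace M] [ChartedSpace H M] [IsManifold I ∞ M]

namespace Spacetime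

variable {S : Spacetime I M} {U : OneForm I M} {DA DB : Set M} {ψ : M → ℝ}

/-- U is the mean of `U + dψ` and `U - dψ`, hence future-directed almost everywhere; continuity does
the rest. Being future timelike is an open condition, so timelike vectors come first and causal ones
follow by adding ε • T. -/
theorem IsWitness.mem_fdc (hψ : S.IsWitness U DA DB ψ) (hU : IsContinuousOneForm I U) {x : M}
    (hx : x ∈ I.interior M) : U x ∈ S.fdc x := by
  have hsrc := mem_chart_source H x
  have hTx := S.T_timelike x hx
  have hG := S.lorentzian.isLorentzForm hx
  have timelike : ∀ v : TangentSpace I x, S.g x v v < 0 → S.g x (S.T x) v < 0 → 0 ≤ U x v := by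
    intro v hv hTv
    obtain ⟨w, rfl⟩ := (frameEquiv I hsrc).surjective v
    rw [frameEquiv_apply] at hv hTv ⊢
    have hO : (chartAt H x).source ∩ I.interior M ∈ 𝓝 x :=
      Filter.inter_mem ((chartAt H x).open_source.mem_nhds hsrc)
        ((I.isOpen_interior (n := ∞) (by simp)).mem_nhds hx)
    have hcT : ContinuousAt (fun y ↦ S.g y (S.T y) (frame I x y w)) x := by
      have h := ContinuousOn.clm_bundle_apply₂ (F₁ := EuclideanSpace ℝ (Fin D))
        (F₂ := EuclideanSpace ℝ (Fin D)) (F₃ := ℝ) (E₁ := fun x : M ↦ TangentSpace I x)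
        (E₂ := fun x : M ↦ TangentSpace I x) (E₃ := Bundle.Trivial M ℝ)
        (s := (chartAt H x).source ∩ I.interior M)
        (S.lorentzian.continuousOn.mono inter_subset_right)
        (S.T_continuousOn.mono inter_subset_right)
        ((continuousOn_frame x w).mono inter_subset_left)
      exact ((Bundle.Trivial.homeomorphProd M ℝ).continuous.comp_continuousOn h).snd.continuousAt hO
    have hcw : ContinuousAt (fun y ↦ coordForm S.g x y w w) x :=
      (((continuousOn_coordForm S.lorentzian x).clm_apply continuousOn_const).clm_apply
        continuousOn_const).continuousAt hO
    have hcU : ContinuousAt (fun y ↦ coordCovector U x y w) x :=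
      ((continuousOn_coordCovector hU x).clm_apply continuousOn_const).continuousAt
        ((chartAt H x).open_source.mem_nhds hsrc)
    by_contra! hneg
    have hev : ∀ᶠ y in 𝓝 x, y ∈ (chartAt H x).source ∩ I.interior M ∧
        S.g y (S.T y) (frame I x y w) < 0 ∧ coordForm S.g x y w w < 0 ∧ coordCovector U x y w < 0 :=
      Filter.Eventually.and hO ((hcT.eventually (gt_mem_nhds hTv)).and ((hcw.eventually (gt_mem_nhds hv)).and
        (hcU.eventually (gt_mem_nhds hneg))))
    have hzt := mem_extChartAt_target (I := I) x
    have hzi : extChartAt I x x ∈ interior (range I) := (mem_interior_iff_range hsrc).1 hx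
    have hsymm := continuousAt_extChartAt_symm (I := I) x
    rw [ContinuousAt, extChartAt_to_inv] at hsymm
    have hev' := (hsymm.eventually hev).and (target_mem_nhds hzt hzi)
    obtain ⟨O, hOsub, hOo, hOx⟩ := mem_nhds_iff.1 hev'
    -- On all of O the vector w is future timelike and U(w) < 0; positive measure supplies a point
    -- of O where the a.e. bound holds.
    refine (hOo.measure_pos volume ⟨_, hOx⟩).ne' (measure_mono_null ?_ (ae_iff.1 (hψ.bound x)))
    intro z hz hgood
    obtain ⟨⟨⟨hs, hi⟩, h1, h2, h3⟩, ht⟩ := hOsub hz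
    obtain ⟨-, ha, hb⟩ := hgood ht hi
    have hfc : S.FutureCausalVec ((extChartAt I x).symm z) (frame I x _ w) :=
      ⟨fun h ↦ by rw [h, map_zero] at h1; exact h1.false, h2.le, h1⟩
    have ha' : 0 ≤ U _ (frame I x _ w) + diff I ψ _ (frame I x _ w) := ha _ hfc
    have hb' : 0 ≤ U _ (frame I x _ w) - diff I ψ _ (frame I x _ w) := hb _ hfc
    have h3' : U _ (frame I x _ w) < 0 := h3
    linarith
  intro v hv
  have hlim : Filter.Tendsto (fun ε : ℝ ↦ U x v + ε * U x (S.T x)) (𝓝[>] 0) (𝓝 (U x v)) := by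
    have : Continuous fun ε : ℝ ↦ U x v + ε * U x (S.T x) := by fun_prop
    have h := this.tendsto 0
    rw [zero_mul, add_zero] at h
    exact h.mono_left nhdsWithin_le_nhds
  refine ge_of_tendsto hlim ?_
  filter_upwards [self_mem_nhdsWithin] with ε hε
  have hε : 0 < ε := hε
  have h1 := timelike (v + ε • S.T x) ?_ ?_
  · simpa using h1
  · have : S.g x (v + ε • S.T x) (v + ε • S.T x) =
        S.g x v v + 2 * ε * S.g x (S.T x) v + ε ^ 2 * S.g x (S.T x) (S.T x) := by
      simp [hG.symm v (S.T x)]; ring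
    rw [this]
    have h2 := hv.2.1
    have h3 : 2 * ε * S.g x (S.T x) v < 0 := mul_neg_of_pos_of_neg (by positivity) hv.2.2
    have h4 : ε ^ 2 * S.g x (S.T x) (S.T x) < 0 := mul_neg_of_pos_of_neg (by positivity) hTx
    linarith
  · have h3 : ε * S.g x (S.T x) (S.T x) < 0 := mul_neg_of_pos_of_neg hε hTx
    simp
    linarith [hv.2.2]

theorem diff_le_coordPairing {x₀ x : M} (hx : x ∈ (chartAt H x₀).source) (hi : x ∈ I.interior M)
    {X : TangentSpace I x →L[ℝ] ℝ} (ha : U x + X ∈ S.fdc x) (hb : U x - X ∈ S.fdc x)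
    (v : EuclideanSpace ℝ (Fin D)) : X (frame I x₀ x v) ≤ S.coordPairing U x₀ x v := by
  rw [← S.wedgedot_eq_coordPairing U hx hi, S.wedgedot_eq_pairing hi]
  exact (S.lorentzian.isLorentzForm hi).le_pairing (S.T_timelike x hi)
    (fun k h1 h2 h3 ↦ ha k ⟨h1, h2, h3⟩) (fun k h1 h2 h3 ↦ hb k ⟨h1, h2, h3⟩) _

/-- The upper slopes of a witness along a curve are bounded by the integrand. -/
theorem IsWitness.eventually_slope_lt (hψ : S.IsWitness U DA DB ψ) (hU : IsContinuousOneForm I U)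
    {γ : ℝ → M} {t : ℝ} (hi : γ t ∈ I.interior M) (hγ : MDifferentiableAt 𝓘(ℝ, ℝ) I γ t) {r : ℝ}
    (hr : S.speed U γ t < r) : ∀ᶠ u in 𝓝[>] t, slope (ψ ∘ γ) t u < r := by
  set x := γ t with hx
  set φ := extChartAt I x with hφ
  have hsrc : x ∈ (chartAt H x).source := mem_chart_source H x
  have hxs : x ∈ φ.source := mem_extChartAt_source x
  have hzt : φ x ∈ φ.target := mem_extChartAt_target x
  have hzi : φ x ∈ interior (range I) := (mem_interior_iff_range hsrc).1 hi
  have hsymm : Filter.Tendsto φ.symm (𝓝 (φ x)) (𝓝 x) := by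
    have := continuousAt_extChartAt_symm (I := I) x
    rwa [ContinuousAt, extChartAt_to_inv] at this
  have hdγ : DifferentiableAt ℝ (φ ∘ γ) t := by
    rw [← mdifferentiableAt_iff_differentiableAt]
    exact (mdifferentiableAt_extChartAt hsrc).comp t hγ
  rw [S.speed_eq_coordPairing U (x₀ := x) hsrc hi hγ] at hr
  obtain ⟨c, hc, hcr⟩ := exists_between hr
  have hcont := (S.continuousOn_coordPairing hU x).continuousAt (x := (x, deriv (φ ∘ γ) t))
    (((chartAt H x).open_source.prod isOpen_univ).mem_nhds ⟨hsrc, mem_univ _⟩)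
  obtain ⟨N, hN, W, hW, hNW⟩ := mem_nhds_prod_iff.1 (hcont.eventually (gt_mem_nhds hc))
  obtain ⟨K, s, hs, hK⟩ := hψ.lipschitz x
  have hs' : s ∈ 𝓝 (φ x) := by
    rwa [nhdsWithin_eq_nhds.2 (mem_interior_iff_mem_nhds.1 hzi)] at hs
  obtain ⟨δ, hδ, hball⟩ := Metric.mem_nhds_iff.1 (Filter.inter_mem
    (Filter.inter_mem (target_mem_nhds hzt hzi) (isOpen_interior.mem_nhds hzi))
    (Filter.inter_mem hs' (hsymm hN)))
  -- The bound c is uniform over base points in the ball and directions in W, so the a.e. estimate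
  -- applies along every chord with direction in W, whether or not ψ is differentiable there.
  have hgrow : ∀ v ∈ W, ∀ h : ℝ, 0 ≤ h → φ x + h • v ∈ Metric.ball (φ x) δ →
      (ψ ∘ φ.symm) (φ x + h • v) - (ψ ∘ φ.symm) (φ x) ≤ c * h := by
    intro v hv h hh hmem
    refine image_sub_le_of_ae_fderiv_le (convex_ball _ _) Metric.isOpen_ball
      (hK.mono fun z hz ↦ (hball hz).2.1) volume ?_ hh (Metric.mem_ball_self hδ) hmem
    filter_upwards [hψ.bound x] with z hz hzb
    obtain ⟨⟨h1, h2⟩, -, h3⟩ := hball hzb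
    have hzs : φ.symm z ∈ (chartAt H x).source := by
      rw [← extChartAt_source I]; exact φ.map_target h1
    have hint := symm_mem_interior h1 h2
    obtain ⟨hd, ha, hb⟩ := hz h1 hint
    have hcoord := (mdifferentiableAt_iff_coord hzs hint hd.continuousAt).1 hd
    have hdf := diff_frame hzs hint hd v
    rw [φ.right_inv h1] at hcoord hdf
    refine ⟨hcoord, ?_⟩
    rw [← hdf]
    refine (diff_le_coordPairing hzs hint ha hb v).trans ?_
    have : (φ.symm z, v) ∈ N ×ˢ W := ⟨h3, hv⟩
    exact (hNW this).le
  have hγc : Filter.Tendsto γ (𝓝[>] t) (𝓝 x) := hγ.continuousAt.tendsto.mono_left nhdsWithin_le_nhds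
  have hφγ : Filter.Tendsto (φ ∘ γ) (𝓝[>] t) (𝓝 (φ x)) :=
    (hdγ.continuousAt.tendsto).mono_left nhdsWithin_le_nhds
  have hslope : Filter.Tendsto (slope (φ ∘ γ) t) (𝓝[>] t) (𝓝 (deriv (φ ∘ γ) t)) :=
    (hasDerivAt_iff_tendsto_slope.1 hdγ.hasDerivAt).mono_left
      (nhdsWithin_mono t fun u (hu : u ∈ Ioi t) ↦ hu.ne')
  filter_upwards [hγc ((isOpen_extChartAt_source x).mem_nhds hxs),
    hφγ (Metric.ball_mem_nhds _ hδ), hslope hW, self_mem_nhdsWithin] with u h1 h2 h3 h4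
  have h4 : 0 < u - t := sub_pos.2 h4
  -- The chord to φ (γ u) has the slope as its direction, which lies in W for u close to t.
  have heq : φ x + (u - t) • slope (φ ∘ γ) t u = φ (γ u) := by
    rw [slope_def_module, smul_smul, mul_inv_cancel₀ h4.ne', one_smul]
    simp [← hx]
  have := hgrow _ h3 (u - t) h4.le (by rw [heq]; exact h2)
  rw [heq] at this
  simp only [Function.comp_apply, φ.left_inv h1, φ.left_inv hxs] at this
  rw [slope_def_field, div_lt_iff₀ h4]
  simp only [Function.comp_apply, ← hx]
  nlinarith

theorem continuousAt_speed (hU : IsContinuousOneForm I U) {γ : ℝ → M} {t : ℝ}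
    (hi : γ t ∈ I.interior M) (hγ : ContMDiffAt 𝓘(ℝ, ℝ) I 1 γ t) :
    ContinuousAt (S.speed U γ) t := by
  set x := γ t with hx
  set φ := extChartAt I x with hφ
  have hsrc : x ∈ (chartAt H x).source := mem_chart_source H x
  have hφγ : ContDiffAt ℝ 1 (φ ∘ γ) t := by
    rw [← contMDiffAt_iff_contDiffAt]
    exact (contMDiffAt_extChartAt (n := 1)).comp t hγ
  have hderiv : ContinuousAt (deriv (φ ∘ γ)) t :=
    (hφγ.continuousAt_fderiv one_ne_zero).clm_apply continuousAt_const
  have hF := (S.continuousOn_coordPairing hU x).continuousAt (x := (x, deriv (φ ∘ γ) t))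
    (((chartAt H x).open_source.prod isOpen_univ).mem_nhds ⟨hsrc, mem_univ _⟩)
  have hcomp : ContinuousAt (fun u ↦ S.coordPairing U x (γ u) (deriv (φ ∘ γ) u)) t :=
    ContinuousAt.comp (f := fun u ↦ (γ u, deriv (φ ∘ γ) u)) (x := t) hF
      (hγ.continuousAt.prodMk hderiv)
  refine hcomp.congr ?_
  filter_upwards [hγ.continuousAt ((chartAt H x).open_source.mem_nhds hsrc),
    hγ.continuousAt ((I.isOpen_interior (n := ∞) (by simp)).mem_nhds hi),
    (contMDiffAt_iff_contMDiffAt_nhds (by simp)).1 hγ] with u h1 h2 h3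
  exact (S.speed_eq_coordPairing U h1 h2 (h3.mdifferentiableAt (by simp))).symm

theorem IsWitness.normBound (hψ : S.IsWitness U DA DB ψ) (hU : IsContinuousOneForm I U) :
    S.NormBound U DA DB := by
  refine ⟨fun x hx ↦ hψ.mem_fdc hU hx, fun γ a b hγ ha hb ↦ ?_⟩
  obtain ⟨s, hs⟩ := hγ.piecewise
  have h := ofReal_sub_le_lintegral (θ := ψ ∘ γ) (L := S.speed U γ) (S.speed_nonneg U γ) s hγ.lt
    (hψ.lipschitz.continuous.comp_continuousOn hγ.continuousOn)
    (fun t ht hts ↦ continuousAt_speed hU (hγ.mapsTo ht) (hs t ht hts))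
    (fun t ht hts r hr ↦ (hψ.eventually_slope_lt hU (hγ.mapsTo ht)
      ((hs t ht hts).mdifferentiableAt (by simp)) hr).frequently)
  have h1 : (ψ ∘ γ) b - (ψ ∘ γ) a = 1 := by
    simp only [Function.comp_apply, hψ.eq_on_A _ ha, hψ.eq_on_B _ hb]
    norm_num
  rwa [h1, ENNReal.ofReal_one] at h

end Spacetime

end NormBound

end UFlow

end

theorem mainTheorem5 {D : ℕ} {H : Type*} [TopologicalSpace H]
    (I : ModelWithCorners ℝ (EuclideanSpace ℝ (Fin D)) H)
    (M : Type*) [TopologicalSpace M] [T2Space M] [CompactSpace M]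
    [ChartedSpace H M] [IsManifold I ∞ M]
    (S : UFlow.Spacetime I M) (DA DB : Set M)
    (hDA : DA ⊆ I.boundary M) (hDB : DB ⊆ I.boundary M)
    (U : UFlow.OneForm I M) (hU : UFlow.IsContinuousOneForm I U) :
    ((∃ ψ : M → ℝ, S.IsWitness U DA DB ψ) ↔ S.NormBound U DA DB) ∧
      (S.NormBound U DA DB → S.IsWitness U DA DB (S.distWitness U DA DB)) :=
  ⟨⟨fun ⟨_, hψ⟩ ↦ hψ.normBound hU, fun hN ↦ ⟨_, UFlow.Spacetime.NormBound.isWitness S hU hN⟩⟩,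
    fun hN ↦ UFlow.Spacetime.NormBound.isWitness S hU hN⟩
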